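/- **Setting (Max-TSP).** Let $G=(V,E)$ be the complete digraph (no loops) on a finite vertex set with $|V|\ge 2$. The players are the edges: player $e\in E$ has a private value $v_e\ge 0$, and gets $v_e$ if $e$ lies on the selected tour (directed Hamiltonian cycle), and $0$ otherwise. A direct mechanism asks for bids $b\in\mathbb R_{\ge0}^E$ and selects a possibly random tour. It is *pay-your-bid* if each selected edge $e$ pays $b_e$. Players are risk neutral with quasi-linear utilities $u_e(b,v_e)$. Let $OPT_T(v)$ be the maximum total value of a tour. A mechanism *achieves a Price of Anarchy of $\beta$* if * in every mixed Nash equilibrium, and in every coarse correlated equilibrium, for every $v$, the expected social welfare is at least $OPT_T(v)/\beta$, and * for all independent value distributions and every mixed Bayes–Nash equilibrium, the expected social welfare is at least $\mathbf E_v[OPT_T(v)]/\beta$. A *relaxation* is a larger finite set $\Omega'$ of outcomes $x'$, each giving every edge $e$ a share $x'_e\ge0$ (a tour has the shares $0,1$), so that the weight of $x'$ for weights $w\in\mathbb R^E_{\ge0}$ is $\sum_e w_e x'_e$. An *$\alpha$-approximate oblivious rounding scheme* maps each $x'\in\Omega'$ to a random tour whose expected weight is at least $\frac1\alpha\sum_e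 w_ex'_e$ for all $w$ simultaneously. An *oblivious rounding mechanism* selects, measurably in $b$, some $x'\in\Omega'$ that maximizes the declared welfare $\sum_e b_e x'_e$, and then applies such a scheme to $x'$. The pay-your-bid mechanism $M'$ that selects the relaxed solution $x'=x'(b)$ itself, where $e$ pays $b_ex'_e$ and has utility $u'_e(b,v_e)=(v_e-b_e)x'_e$, is *$(\lambda,\mu)$-smooth for deviations to half the value* against a benchmark $OPT$ if for all $v,b$ $$\sum_{e}u'_e\big((\tfrac12 v_e,b_{-e}),v_e\big)\ \ge\ \lambda\, OPT(v)-\mu\sum_e b_e\,x'_e(b).$$ A *cycle cover* is a set of directed cycles (of length at least $2$) such that each vertex lies on exactly one of them. For *cycle covers without $2$-cycles but with half-edges*, split every edge $(u,v)$ into a tail half leaving $u$ and a head half entering $v$, each carrying half of the value of $(u,v)$; one selects a set of half-edges such that each vertex has exactly one outgoing and exactly one incoming half-edge, and such that of the four half-edges of $(u,v)$ and $(v,u)$ either none or exactly two are selected, in the latter case one incident to $u$ and one incident to $v$. **Theorem.** 1. There is a pay-your-bid oblivious rounding mechanism for Max-TSP (with a $\frac32$-approximate oblivious rounding scheme) that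 achieves a Price of Anarchy of $9$. 2. (Fisher's algorithm.) Cycle covers form a relaxation, and for them a measurable exact maximizer of the declared welfare exists. For every such maximizer, $M'$ is $(\frac12,3)$-smooth for deviations to half the value against the maximum value of a cycle cover. Removing from each cycle of a cycle cover one edge uniformly at random (independently) and connecting the remaining paths to a tour is always possible and, whichever way the paths are connected, is a $2$-approximate oblivious rounding scheme. For every such maximizer and every way of connecting the paths, the resulting pay-your-bid mechanism achieves a Price of Anarchy of $12$. 3. (Paluch et al.) Let $|V|\ge3$. Cycle covers without $2$-cycles but with half-edges form a relaxation, and for them a measurable exact maximizer of the declared welfare exists. For every such maximizer, $M'$ is $(\frac12,3)$-smooth for deviations to half the value against $OPT_T$. To each such cover one can assign three tours such that choosing one of the three uniformly at random is a $\frac32$-approximate oblivious rounding scheme, and for every such maximizer the resulting pay-your-bid mechanism achieves a Price of Anarchy of $9$. -/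

import Mathlib

open MeasureTheory ProbabilityTheory
open scoped NNReal ENNReal

noncomputable section

namespace MaxTSP

/-! ## Mechanisms in which player `i` with value `v i` has valuation `x ↦ v i * share x i` -/

section Mechanisms

variable {N Ω Ω' : Type*}

/-- A direct (possibly randomized) mechanism: the random outcome selected for a bid profile, and
the payment of each player under a bid profile and the realized outcome. -/
structure Mechanism (N Ω : Type*) where
  outcome : (N → ℝ≥0) → PMF Ω
  payment : (N → ℝ≥0) → Ω → N → ℝ≥0

/-- The pay-your-bid mechanism with outcome rule `f`: each player pays the value that she declared
for the realized outcome. -/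
def payYourBid (share : Ω → N → ℝ≥0) (f : (N → ℝ≥0) → PMF Ω) : Mechanism N Ω where
  outcome := f
  payment := fun b x i => b i * share x i

/-- Total weight (social welfare) of the outcome `x` for the weights `w`. -/
def welfare [Fintype N] (share : Ω → N → ℝ≥0) (w : N → ℝ≥0) (x : Ω) : ℝ≥0 := ∑ i, w i * share x i

/-- The optimal social welfare over all outcomes in `Ω`. -/
def opt [Fintype N] (share : Ω → N → ℝ≥0) (v : N → ℝ≥0) : ℝ≥0 := ⨆ x : Ω, welfare share v x

/-- Expected value (over the randomness of the mechanism) of a player `i` with value `w`. -/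
def expValue [Fintype Ω] (share : Ω → N → ℝ≥0) (M : Mechanism N Ω) (i : N) (w : ℝ≥0)
    (b : N → ℝ≥0) : ℝ≥0 :=
  ∑ x, (M.outcome b x).toNNReal * (w * share x i)

/-- Expected payment (over the randomness of the mechanism) of player `i`. -/
def expPayment [Fintype Ω] (M : Mechanism N Ω) (i : N) (b : N → ℝ≥0) : ℝ≥0 :=
  ∑ x, (M.outcome b x).toNNReal * M.payment b x i

/-- Quasi-linear expected utility of a player `i` with value `w` under the bid profile `b`. -/
def utility [Fintype Ω] (share : Ω → N → ℝ≥0) (M : Mechanism N Ω) (i : N) (w : ℝ≥0)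
    (b : N → ℝ≥0) : ℝ :=
  (expValue share M i w b : ℝ) - (expPayment M i b : ℝ)

/-- `(lam, mu)`-smoothness for unilateral deviations to half the value, measured against a
benchmark `OPT v`. -/
def SmoothForHalfValue [Fintype N] [DecidableEq N] [Fintype Ω] (share : Ω → N → ℝ≥0)
    (M : Mechanism N Ω) (OPT : (N → ℝ≥0) → ℝ≥0) (lam mu : ℝ) : Prop :=
  ∀ v b : N → ℝ≥0,
    lam * (OPT v : ℝ) - mu * ∑ i, (expPayment M i b : ℝ)
      ≤ ∑ i, utility share M i (v i) (Function.update b i (v i / 2))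

/-! ### Relaxations and oblivious rounding -/

/-- `Ω'` contains a copy of `Ω`, and valuations on `Ω'` extend those on `Ω`. -/
def IsRelaxation (share : Ω → N → ℝ≥0) (share' : Ω' → N → ℝ≥0) : Prop :=
  ∃ ι : Ω → Ω', Function.Injective ι ∧ ∀ x, share' (ι x) = share x

/-- `R` is an `α`-approximate oblivious rounding scheme: the (random) rounded solution keeps in
expectation a `1 / α` fraction of the weight of the relaxed solution, for all weights at once. -/
def IsObliviousRounding [Fintype N] [Fintype Ω] (share : Ω → N → ℝ≥0) (share' : Ω' → N → ℝ≥0)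
    (α : ℝ≥0) (R : Ω' → PMF Ω) : Prop :=
  ∀ (x' : Ω') (w : N → ℝ≥0),
    1 / α * welfare share' w x' ≤ ∑ x, (R x' x).toNNReal * welfare share w x

/-- `f'` selects, measurably in the bids, an outcome of maximum declared welfare. -/
def IsExactMaximizer [Fintype N] (share' : Ω' → N → ℝ≥0) (f' : (N → ℝ≥0) → Ω') : Prop :=
  Measurable[_, ⊤] f' ∧ ∀ b x', welfare share' b x' ≤ welfare share' b (f' b)

/-- The pay-your-bid mechanism that selects the relaxed solution `f' b`. -/
def relaxedMechanism (share' : Ω' → N → ℝ≥0) (f' : (N → ℝ≥0) → Ω') : Mechanism N Ω' :=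
  payYourBid share' fun b => PMF.pure (f' b)

/-- The pay-your-bid mechanism that rounds the relaxed solution `f' b` by `R`. -/
def roundedMechanism (share : Ω → N → ℝ≥0) (f' : (N → ℝ≥0) → Ω') (R : Ω' → PMF Ω) :
    Mechanism N Ω :=
  payYourBid share fun b => R (f' b)

/-! ### Equilibria and the Price of Anarchy -/

/-- Expected utility of a player `i` with value `w` if the bid profile is drawn from `μ`.
It lies in `[-∞, ∞)`. -/
def mixedUtility [Fintype Ω] (share : Ω → N → ℝ≥0) (M : Mechanism N Ω) (i : N) (w : ℝ≥0) (μ : Measure (N → ℝ≥0)) : EReal :=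
  ((∫⁻ b, (expValue share M i w b : ℝ≥0∞) ∂μ : ℝ≥0∞) : EReal)
    - ((∫⁻ b, (expPayment M i b : ℝ≥0∞) ∂μ : ℝ≥0∞) : EReal)

/-- The law of the bid profile when bids are drawn from `μ`, except that player `i` bids `b'`. -/
def deviate [DecidableEq N] (μ : Measure (N → ℝ≥0)) (i : N) (b' : ℝ≥0) : Measure (N → ℝ≥0) :=
  μ.map fun b => Function.update b i b'

/-- If bids are drawn from `μ`, player `i` with value `w` has no profitable deviation. -/
def NoProfitableDeviation [DecidableEq N] [Fintype Ω] (share : Ω → N → ℝ≥0)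
    (M : Mechanism N Ω) (i : N) (w : ℝ≥0) (μ : Measure (N → ℝ≥0)) : Prop :=
  ∀ b' : ℝ≥0, mixedUtility share M i w (deviate μ i b') ≤ mixedUtility share M i w μ

/-- Coarse correlated equilibrium (learning outcome) at valuations `v`: a joint law of bids. -/
def IsCoarseCorrelated [DecidableEq N] [Fintype Ω] (share : Ω → N → ℝ≥0) (M : Mechanism N Ω)
    (v : N → ℝ≥0) (μ : ProbabilityMeasure (N → ℝ≥0)) : Prop :=
  ∀ i, NoProfitableDeviation share M i (v i) μ

/-- Mixed Nash equilibrium at valuations `v`: the players randomize independently. -/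
def IsMixedNash [Fintype N] [DecidableEq N] [Fintype Ω] (share : Ω → N → ℝ≥0)
    (M : Mechanism N Ω) (v : N → ℝ≥0) (σ : N → ProbabilityMeasure ℝ≥0) : Prop :=
  ∀ i, NoProfitableDeviation share M i (v i) (Measure.pi fun j => (σ j : Measure ℝ≥0))

/-- The law of the bid profile from the point of view of player `i` with value `t`: her own bid
has law `s i t`, and every other player `j` draws a value from `D j` and then bids by `s j`. -/
def interimBids [Fintype N] [DecidableEq N] (D : N → ProbabilityMeasure ℝ≥0)
    (s : N → Kernel ℝ≥0 ℝ≥0) (i : N) (t : ℝ≥0) : Measure (N → ℝ≥0) :=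
  Measure.pi (Function.update (fun j => (D j : Measure ℝ≥0).bind (s j)) i (s i t))

/-- Mixed Bayes-Nash equilibrium for independent values `v i ∼ D i`: the randomized strategy
`s i` of player `i` depends on her own value only. -/
def IsMixedBayesNash [Fintype N] [DecidableEq N] [Fintype Ω] (share : Ω → N → ℝ≥0)
    (M : Mechanism N Ω) (D : N → ProbabilityMeasure ℝ≥0) (s : N → Kernel ℝ≥0 ℝ≥0) : Prop :=
  (∀ i, IsMarkovKernel (s i)) ∧
    ∀ i, ∀ᵐ t ∂(D i : Measure ℝ≥0), NoProfitableDeviation share M i t (interimBids D s i t)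

/-- Expected social welfare of the mechanism for values `v` and bids `b`. -/
def expWelfare [Fintype N] [Fintype Ω] (share : Ω → N → ℝ≥0) (M : Mechanism N Ω)
    (v b : N → ℝ≥0) : ℝ≥0 :=
  ∑ x, (M.outcome b x).toNNReal * welfare share v x

/-- The joint law of all pairs `(v i, b i)` of a value and a bid under `D` and `s`. -/
def valuesAndBids [Fintype N] (D : N → ProbabilityMeasure ℝ≥0) (s : N → Kernel ℝ≥0 ℝ≥0) :
    Measure (N → ℝ≥0 × ℝ≥0) :=
  Measure.pi fun i => (D i : Measure ℝ≥0).compProd (s i)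

/-- Price of Anarchy with respect to mixed Nash equilibria. -/
def PoA [Fintype N] [DecidableEq N] [Fintype Ω] (share : Ω → N → ℝ≥0)
    (M : Mechanism N Ω) : ℝ≥0∞ :=
  ⨆ (v : N → ℝ≥0) (σ : N → ProbabilityMeasure ℝ≥0) (_ : IsMixedNash share M v σ),
    (opt share v : ℝ≥0∞) /
      ∫⁻ b, (expWelfare share M v b : ℝ≥0∞) ∂(Measure.pi fun j => (σ j : Measure ℝ≥0))

/-- Price of Anarchy with respect to mixed Bayes-Nash equilibria. -/
def BPoA [Fintype N] [DecidableEq N] [Fintype Ω] (share : Ω → N → ℝ≥0)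
    (M : Mechanism N Ω) : ℝ≥0∞ :=
  ⨆ (D : N → ProbabilityMeasure ℝ≥0) (s : N → Kernel ℝ≥0 ℝ≥0)
    (_ : IsMixedBayesNash share M D s),
    (∫⁻ v, (opt share v : ℝ≥0∞) ∂(Measure.pi fun j => (D j : Measure ℝ≥0))) /
      ∫⁻ y, (expWelfare share M (fun i => (y i).1) (fun i => (y i).2) : ℝ≥0∞)
        ∂(valuesAndBids D s)

/-- Price of Anarchy with respect to coarse correlated equilibria. -/
def CCPoA [Fintype N] [DecidableEq N] [Fintype Ω] (share : Ω → N → ℝ≥0)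
    (M : Mechanism N Ω) : ℝ≥0∞ :=
  ⨆ (v : N → ℝ≥0) (μ : ProbabilityMeasure (N → ℝ≥0)) (_ : IsCoarseCorrelated share M v μ),
    (opt share v : ℝ≥0∞) /
      ∫⁻ b, (expWelfare share M v b : ℝ≥0∞) ∂(μ : Measure (N → ℝ≥0))

/-- The mechanism achieves a Price of Anarchy of `β`, for mixed Nash equilibria, for mixed
Bayes-Nash equilibria, and for coarse correlated equilibria. -/
def AchievesPoA [Fintype N] [DecidableEq N] [Fintype Ω] (share : Ω → N → ℝ≥0)
    (M : Mechanism N Ω) (β : ℝ≥0∞) : Prop :=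
  PoA share M ≤ β ∧ BPoA share M ≤ β ∧ CCPoA share M ≤ β

end Mechanisms

/-- `M` is a pay-your-bid mechanism that solves some relaxation exactly for the declared bids and
applies an `α`-approximate oblivious rounding scheme to the solution. -/
def IsObliviousRoundingMechanism.{u, w} {N : Type w} {Ω : Type u} [Fintype N] [Fintype Ω]
    (share : Ω → N → ℝ≥0) (α : ℝ≥0) (M : Mechanism N Ω) : Prop :=
  ∃ (Ω' : Type u) (_ : Fintype Ω') (share' : Ω' → N → ℝ≥0) (f' : (N → ℝ≥0) → Ω')
    (R : Ω' → PMF Ω),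
    IsRelaxation share share' ∧ IsExactMaximizer share' f' ∧
      IsObliviousRounding share share' α R ∧ M = roundedMechanism share f' R

/-! ## Tours, cycle covers, and cycle covers without 2-cycles but with half-edges -/

section TSP

/-- The edges of the complete digraph on `V`; they are the players. -/
abbrev Edge (V : Type*) : Type _ := {p : V × V // p.1 ≠ p.2}

/-- The source of an edge. -/
abbrev Edge.src {V : Type*} (e : Edge V) : V := e.1.1

/-- The target of an edge. -/
abbrev Edge.tgt {V : Type*} (e : Edge V) : V := e.1.2

/-- The reverse edge. -/
def Edge.rev {V : Type*} (e : Edge V) : Edge V := ⟨(e.1.2, e.1.1), e.2.symm⟩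

variable (V : Type*) [Fintype V] [DecidableEq V]

/-- Hamiltonian cycles of the complete digraph, given by their successor maps: permutations that
consist of one cycle through all vertices. -/
abbrev Tour : Type _ := {τ : Equiv.Perm V // τ.IsCycle ∧ τ.support = Finset.univ}

/-- Cycle covers of the complete digraph, given by their successor maps. -/
abbrev CycleCover : Type _ := {σ : Equiv.Perm V // ∀ u, σ u ≠ u}

instance : Fintype (Tour V) := Fintype.ofFinite _

variable {V}

/-- Edge `e` gets its value if it lies on the tour. -/
def tourShare (τ : Tour V) (e : Edge V) : ℝ≥0 := if τ.1 e.src = e.tgt then 1 else 0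

/-- Edge `e` gets its value if it lies on one of the cycles. -/
def coverShare (σ : CycleCover V) (e : Edge V) : ℝ≥0 := if σ.1 e.src = e.tgt then 1 else 0

/-- Every edge `(u, v)` has two half-edges, a tail half (leaving `u`) and a head half (entering
`v`). The edges whose tail halves, respectively head halves, are selected form a cycle cover
without 2-cycles but with half-edges. -/
structure IsHalfEdgeCover (tails heads : Finset (Edge V)) : Prop where
  /-- Every vertex has outdegree one. -/
  outdegree : ∀ u : V, ∃! e : Edge V, e ∈ tails ∧ e.src = u
  /-- Every vertex has indegree one. -/
  indegree : ∀ u : V, ∃! e : Edge V, e ∈ heads ∧ e.tgt = u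
  /-- Of the four half-edges between two vertices, none or exactly two are selected. -/
  none_or_two : ∀ e : Edge V,
    (tails ∩ {e, e.rev}).card + (heads ∩ {e, e.rev}).card = 0 ∨
      (tails ∩ {e, e.rev}).card + (heads ∩ {e, e.rev}).card = 2
  /-- The two half-edges selected between two vertices are not incident to the same vertex. -/
  not_same_vertex : ∀ e : Edge V, ¬ (e ∈ tails ∧ e.rev ∈ heads)

variable (V) in
/-- Cycle covers without 2-cycles but with half-edges: the pair (tail halves, head halves). -/
abbrev HalfEdgeCover : Type _ :=
  {H : Finset (Edge V) × Finset (Edge V) // IsHalfEdgeCover H.1 H.2}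

variable (V) in
instance : Fintype (HalfEdgeCover V) := Fintype.ofFinite _

/-- Each of the two half-edges of `e` carries half of the value of `e`. -/
def halfEdgeShare (H : HalfEdgeCover V) (e : Edge V) : ℝ≥0 :=
  (if e ∈ H.1.1 then 1 / 2 else 0) + (if e ∈ H.1.2 then 1 / 2 else 0)

/-! ### Fisher's rounding: remove a random edge from each cycle and reconnect -/

/-- A choice of one edge `(u, σ u)` of each cycle of `σ`, given by the source `u`. -/
abbrev Removal (σ : CycleCover V) : Type _ :=
  (c : {c // c ∈ σ.1.cycleFactorsFinset}) → {u : V // u ∈ c.1.support}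

instance (σ : CycleCover V) (c : {c // c ∈ σ.1.cycleFactorsFinset}) :
    Nonempty {u : V // u ∈ c.1.support} := by
  obtain ⟨u, hu, -⟩ := (Equiv.Perm.mem_cycleFactorsFinset_iff.mp c.2).1
  exact ⟨⟨u, Equiv.Perm.mem_support.mpr hu⟩⟩

/-- `g` connects the paths that are left after the removal of one edge from each cycle to a tour,
in an arbitrary way: every edge of the cycle cover that is not removed lies on the tour. -/
def IsPatching (g : (σ : CycleCover V) → Removal σ → Tour V) : Prop :=
  ∀ (σ : CycleCover V) (r : Removal σ) (u : V), (∀ c, (r c : V) ≠ u) → (g σ r).1 u = σ.1 u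

/-- One edge of each cycle is removed uniformly (and independently) at random, and the paths are
connected by `g`. -/
def fisherRounding (g : (σ : CycleCover V) → Removal σ → Tour V) (σ : CycleCover V) :
    PMF (Tour V) :=
  (PMF.uniformOfFintype (Removal σ)).map (g σ)

/-! ### Rounding into one of three tours -/

/-- One of the three tours `T H 0`, `T H 1`, `T H 2` is chosen uniformly at random. -/
def threeTourRounding (T : HalfEdgeCover V → Fin 3 → Tour V) (H : HalfEdgeCover V) :
    PMF (Tour V) :=
  (PMF.uniformOfFintype (Fin 3)).map (T H)

end TSP

end MaxTSP

end

open MaxTSP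

/-!
Smoothness turns into a Price of Anarchy as follows (`achievesPoA_of_smooth`). In equilibrium,
bidding half of her value does not pay for a player, so her expected value is at least what the
deviation would earn plus her expected payment. Summed over the players, and combined with the
smoothness inequality, this bounds the optimum by a multiple of the welfare. The deviation does not
depend on the values of the others; hence in the Bayesian case the smoothness inequality can be
averaged over a value profile and an independent copy of the equilibrium bids. All inequalities are
kept in `ℝ≥0∞` and without subtraction, so that infinite means need no separate treatment. Rounding
keeps the share of each single player up to the factor `α`, and thus loses this factor in the
smoothness inequality (`achievesPoA_roundedMechanism`).

Smoothness of a relaxation comes from exchanges (`smoothForHalfValue_of_exchange`): if an edge `e`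
of the optimal solution can be inserted into the current solution at the loss of declared welfare
`L e`, then the bid `v e / 2` earns at least `v e / 2 - L e`. In a cycle cover, inserting `(u, w)`
costs the edges leaving `u`, entering `w` and leaving `w`, so that every edge is charged three times
(`exists_cover_exchange`). A cycle cover without 2-cycles but with half-edges is encoded as an
involution on the half-edges `V × Bool` (`IsGluing`, `Encodes`), that is, a disjoint union of
undirected cycles of length at least three with an outgoing and an ingoing half-edge at each
vertex, chosen independently. Exchanges are 2-switches of the undirected cycles; where the obvious
one is not possible there are two others, and averaging their losses gives the same total charge
of three (`IsGluing.exists_exchange_le`, `sum_exchangeLoss`).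

For the roundings, a permutation can be changed into a tour on any set of vertices that meets all
its cycles, because multiplication by a transposition merges two cycles (`exists_tour_eq_off`). This
completes disjoint paths to tours. Fisher's rounding keeps each edge with probability at least
one half, as all cycles have length at least two. For the other relaxation, orient the undirected
cycles (`IsGluing.exists_orientation`). An edge with two selected halves is needed on two of the
three tours, an edge with one selected half on one of them. One tour takes the forward edges, one
takes the backward edges, and one takes the second copies of the doubled edges; a few edges change
the tour where a full cycle would appear (`exists_isThreeColoring`).
-/

namespace MaxTSP

/-! ### From smoothness to the Price of Anarchy -/

section Smoothness

variable {N Ω Ω' : Type*}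

/-- If the allocation is linear in the value of the player and she pays her bid, then in the absence
of profitable deviations she does at least as well as by bidding half of her value: the utility
that she would get in this way plus her payment is at most her expected value. The inequality
is stated without subtraction, so that it also covers the case of infinite expected payments. -/
lemma lintegral_half_add_payment_le [DecidableEq N] [Fintype Ω] {share : Ω → N → ℝ≥0}
    {M : Mechanism N Ω} {q : (N → ℝ≥0) → N → ℝ≥0} (hq : ∀ i, Measurable fun b => q b i)
    (hq1 : ∀ b i, q b i ≤ 1)
    (hval : ∀ i w b, expValue share M i w b = w * q b i)
    (hpay : ∀ i b, expPayment M i b = b i * q b i) {i : N} {w : ℝ≥0}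
    {μ : Measure (N → ℝ≥0)} [IsProbabilityMeasure μ]
    (h : NoProfitableDeviation share M i w μ) :
    ∫⁻ b, (w / 2 * q (Function.update b i (w / 2)) i : ℝ≥0) ∂μ + ∫⁻ b, (b i * q b i : ℝ≥0) ∂μ
      ≤ ∫⁻ b, (w * q b i : ℝ≥0) ∂μ := by
  have hu : Measurable fun b : N → ℝ≥0 => Function.update b i (w / 2) := by fun_prop
  have hi := hq i
  have h := h (w / 2)
  unfold mixedUtility deviate at h
  simp only [hval, hpay] at h
  rw [lintegral_map (by fun_prop) hu, lintegral_map (by fun_prop) hu] at h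
  simp only [Function.update_self] at h
  have hsplit : ∫⁻ b, (w * q (Function.update b i (w / 2)) i : ℝ≥0) ∂μ
      = ∫⁻ b, (w / 2 * q (Function.update b i (w / 2)) i : ℝ≥0) ∂μ
        + ∫⁻ b, (w / 2 * q (Function.update b i (w / 2)) i : ℝ≥0) ∂μ := by
    rw [← lintegral_add_left (by fun_prop)]
    congr 1 with b
    rw [← ENNReal.coe_add, ← add_mul, add_halves]
  rw [hsplit] at h
  have hY : ∫⁻ b, (w / 2 * q (Function.update b i (w / 2)) i : ℝ≥0) ∂μ ≠ ⊤ := by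
    refine ne_top_of_le_ne_top (ENNReal.coe_ne_top (r := w / 2)) ?_
    calc _ ≤ ∫⁻ _, ((w / 2 : ℝ≥0) : ℝ≥0∞) ∂μ := by
          refine lintegral_mono fun b => ?_
          exact ENNReal.coe_le_coe.2 (mul_le_of_le_one_right' (hq1 _ _))
      _ = _ := by simp
  have hZ : ∫⁻ b, (w * q b i : ℝ≥0) ∂μ ≠ ⊤ := by
    refine ne_top_of_le_ne_top (ENNReal.coe_ne_top (r := w)) ?_
    calc _ ≤ ∫⁻ _, (w : ℝ≥0∞) ∂μ := by
          refine lintegral_mono fun b => ?_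
          exact ENNReal.coe_le_coe.2 (mul_le_of_le_one_right' (hq1 _ _))
      _ = _ := by simp
  generalize ∫⁻ b, (w / 2 * q (Function.update b i (w / 2)) i : ℝ≥0) ∂μ = Y at *
  generalize ∫⁻ b, (w * q b i : ℝ≥0) ∂μ = Z at *
  generalize ∫⁻ b, (b i * q b i : ℝ≥0) ∂μ = P at *
  lift Y to ℝ≥0 using hY
  lift Z to ℝ≥0 using hZ
  induction P with
  | top =>
    exfalso
    rw [← ENNReal.coe_add] at h
    have h1 : ((Z : ℝ≥0∞) : EReal) - ((⊤ : ℝ≥0∞) : EReal) = ⊥ := by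
      rw [EReal.coe_ennreal_top]; exact EReal.sub_top _
    rw [h1, le_bot_iff] at h
    have h2 : (((Y + Y : ℝ≥0) : ℝ≥0∞) : EReal) - ((Y : ℝ≥0∞) : EReal)
        = (((Y + Y : ℝ≥0) - Y : ℝ) : EReal) := rfl
    rw [h2] at h
    exact EReal.coe_ne_bot _ h
  | coe P =>
    have h' : (((Y + Y : ℝ≥0) - Y : ℝ) : EReal) ≤ ((Z - P : ℝ) : EReal) := h
    rw [EReal.coe_le_coe_iff] at h'
    push_cast at h'
    rw [← ENNReal.coe_add, ENNReal.coe_le_coe, ← NNReal.coe_le_coe]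
    push_cast
    linarith

/-- Joining the deviation inequalities of all players with the smoothness inequality, in
expectation: `O` is the expected optimum, `Dev i`, `Pay i` and `Val i` are what player `i` would
get by deviating, what she pays and what she gets. -/
lemma le_of_smooth_of_deviation [Fintype N] {O C : ℝ≥0∞} {Dev Pay Val : N → ℝ≥0∞}
    (hsm : O ≤ C * (∑ i, Dev i + 3 * ∑ i, Pay i)) (hdev : ∀ i, Dev i + Pay i ≤ Val i) :
    O ≤ 3 * C * ∑ i, Val i := by
  calc O ≤ C * (∑ i, Dev i + 3 * ∑ i, Pay i) := hsm
    _ ≤ C * (3 * ∑ i, Dev i + 3 * ∑ i, Pay i) := by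
        gcongr
        exact le_mul_of_one_le_left' (by norm_num)
    _ = 3 * C * ∑ i, (Dev i + Pay i) := by rw [Finset.sum_add_distrib]; ring
    _ ≤ 3 * C * ∑ i, Val i := by gcongr with i; exact hdev i

lemma expWelfare_eq_sum [Fintype N] [Fintype Ω] {share : Ω → N → ℝ≥0}
    {M : Mechanism N Ω} {q : (N → ℝ≥0) → N → ℝ≥0}
    (hval : ∀ i w b, expValue share M i w b = w * q b i) (v b : N → ℝ≥0) :
    expWelfare share M v b = ∑ i, v i * q b i := by
  simp only [expWelfare, welfare, Finset.mul_sum, ← hval]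
  rw [Finset.sum_comm]
  rfl

lemma measurable_update_prod [DecidableEq N] {X : Type*} [MeasurableSpace X] (i : N) :
    Measurable fun p : X × (N → X) => Function.update p.2 i p.1 := by
  rw [measurable_pi_iff]
  intro j
  by_cases hj : j = i
  · subst hj; simpa using measurable_fst
  · simp only [Function.update_of_ne hj]; fun_prop

/-- Replacing the law of one factor of a product of probability measures amounts to resampling
the corresponding coordinate. -/
lemma pi_update_eq_map [Fintype N] [DecidableEq N] {X : Type*} [MeasurableSpace X]
    (m : N → Measure X) [∀ i, IsProbabilityMeasure (m i)] (i : N) (ν : Measure X)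
    [IsProbabilityMeasure ν] :
    Measure.pi (Function.update m i ν)
      = (ν.prod (Measure.pi m)).map (fun p => Function.update p.2 i p.1) := by
  have : ∀ j, IsProbabilityMeasure (Function.update m i ν j) := by
    intro j
    by_cases hj : j = i
    · subst hj; simpa
    · simp only [Function.update_of_ne hj]; infer_instance
  refine Measure.pi_eq fun s hs => ?_
  rw [Measure.map_apply (measurable_update_prod i) (MeasurableSet.univ_pi hs)]
  have hpre : (fun p : X × (N → X) => Function.update p.2 i p.1) ⁻¹' Set.univ.pi s
      = s i ×ˢ Set.univ.pi (Function.update s i Set.univ) := by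
    ext ⟨x, y⟩
    simp only [Set.mem_preimage, Set.mem_pi, Set.mem_univ, true_imp_iff, Set.mem_prod]
    constructor
    · intro h
      refine ⟨by simpa using h i, fun j => ?_⟩
      by_cases hj : j = i
      · subst hj; simp
      · simpa [Function.update_of_ne hj] using h j
    · rintro ⟨h1, h2⟩ j
      by_cases hj : j = i
      · subst hj; simpa
      · simpa [Function.update_of_ne hj] using h2 j
  rw [hpre, Measure.prod_prod, Measure.pi_pi]
  rw [← Finset.mul_prod_erase _ _ (Finset.mem_univ i),
    ← Finset.mul_prod_erase _ _ (Finset.mem_univ i)]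
  simp only [Function.update_self, measure_univ, one_mul]
  congr 1
  refine Finset.prod_congr rfl fun j hj => ?_
  rw [Function.update_of_ne (Finset.ne_of_mem_erase hj),
    Function.update_of_ne (Finset.ne_of_mem_erase hj)]

lemma lintegral_pi_update [Fintype N] [DecidableEq N] {X : Type*} [MeasurableSpace X]
    (m : N → Measure X) [∀ i, IsProbabilityMeasure (m i)] (i : N) (ν : Measure X)
    [IsProbabilityMeasure ν] {G : (N → X) → ℝ≥0∞} (hG : Measurable G) :
    ∫⁻ y, G y ∂(Measure.pi (Function.update m i ν))
      = ∫⁻ x, ∫⁻ y, G (Function.update y i x) ∂(Measure.pi m) ∂ν := by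
  rw [pi_update_eq_map, lintegral_map hG (measurable_update_prod i), lintegral_prod]
  exact (hG.comp (measurable_update_prod i)).aemeasurable

end Smoothness

section PriceOfAnarchy

variable {N Ω Ω' : Type*}

section Bayes

variable [Fintype N] [DecidableEq N] (D : N → ProbabilityMeasure ℝ≥0) (s : N → Kernel ℝ≥0 ℝ≥0)
  [∀ i, IsMarkovKernel (s i)]

lemma map_snd_valuesAndBids {N : Type*} [Fintype N] (D : N → ProbabilityMeasure ℝ≥0)
    (s : N → Kernel ℝ≥0 ℝ≥0) [∀ i, IsMarkovKernel (s i)] :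
    (valuesAndBids D s).map (fun y j => (y j).2)
      = Measure.pi fun j => (D j : Measure ℝ≥0).bind (s j) := by
  have h : ∀ j, ((D j : Measure ℝ≥0).compProd (s j)).map Prod.snd
      = (D j : Measure ℝ≥0).bind (s j) := fun j => Measure.snd_compProd _ _
  have : ∀ j, SigmaFinite (((D j : Measure ℝ≥0).compProd (s j)).map Prod.snd) := by
    intro j; rw [h]; infer_instance
  unfold valuesAndBids
  rw [Measure.pi_map_pi (fun j => measurable_snd.aemeasurable)]
  simp only [h]

/-- A deviation of a player does not depend on the law of her own bids. -/
lemma lintegral_interimBids_update (i : N) (t b' : ℝ≥0) {G : (N → ℝ≥0) → ℝ≥0∞}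
    (hG : Measurable G) :
    ∫⁻ b, G (Function.update b i b') ∂(interimBids D s i t)
      = ∫⁻ b, G (Function.update b i b')
        ∂(Measure.pi fun j => (D j : Measure ℝ≥0).bind (s j)) := by
  unfold interimBids
  rw [lintegral_pi_update (G := fun b => G (Function.update b i b')) _ _ _
    (hG.comp (by fun_prop))]
  simp

/-- Averaging the interim view of player `i` over her values gives the joint law of her value and
of all bids. -/
lemma lintegral_interimBids (i : N) {G : ℝ≥0 → (N → ℝ≥0) → ℝ≥0∞}
    (hG : Measurable (Function.uncurry G)) :
    ∫⁻ t, ∫⁻ b, G t b ∂(interimBids D s i t) ∂(D i : Measure ℝ≥0)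
      = ∫⁻ y, G (y i).1 (fun j => (y j).2) ∂(valuesAndBids D s) := by
  have hvb : valuesAndBids D s = Measure.pi (Function.update
      (fun j => (D j : Measure ℝ≥0).compProd (s j)) i ((D i : Measure ℝ≥0).compProd (s i))) := by
    rw [Function.update_eq_self]; rfl
  have hF : Measurable fun y : N → ℝ≥0 × ℝ≥0 => G (y i).1 (fun j => (y j).2) := by
    refine hG.comp (Measurable.prodMk (by fun_prop) ?_)
    exact measurable_pi_iff.2 fun j => by fun_prop
  have hupd : Measurable fun p : (ℝ≥0 × ℝ≥0) × (N → ℝ≥0) =>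
      G p.1.1 (Function.update p.2 i p.1.2) := by
    refine hG.comp (Measurable.prodMk (by fun_prop) ?_)
    exact (measurable_update_prod i).comp (Measurable.prodMk (by fun_prop) (by fun_prop))
  rw [hvb, lintegral_pi_update _ _ _ hF]
  have hmap : ∀ x : ℝ≥0 × ℝ≥0,
      ∫⁻ y, G (Function.update y i x i).1 (fun j => (Function.update y i x j).2)
        ∂(Measure.pi fun j => (D j : Measure ℝ≥0).compProd (s j))
      = ∫⁻ b, G x.1 (Function.update b i x.2)
        ∂(Measure.pi fun j => (D j : Measure ℝ≥0).bind (s j)) := by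
    intro x
    rw [← map_snd_valuesAndBids, lintegral_map (by exact hupd.comp measurable_prodMk_left)
      (measurable_pi_iff.2 fun j => by fun_prop)]
    unfold valuesAndBids
    congr 1 with y
    congr 1
    · simp
    · ext j
      by_cases hj : j = i
      · subst hj; simp
      · simp [Function.update_of_ne hj]
  simp only [hmap]
  rw [Measure.lintegral_compProd (by exact hupd.lintegral_prod_right')]
  refine lintegral_congr fun t => ?_
  unfold interimBids
  rw [lintegral_pi_update _ _ _ (by exact hG.comp measurable_prodMk_left)]

end Bayes

variable [Fintype N] [DecidableEq N] [Fintype Ω]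

/-- Smoothness of a mechanism whose allocation `q` is linear in the value, for deviations to half
the value, bounds the Price of Anarchy for all three solution concepts. In the Bayesian case the
smoothness inequality is averaged over a value profile and an independent bid profile with the
equilibrium law: the deviation to `v i / 2` depends on the value of player `i` only, and she
competes with bids that are independent of it. -/
lemma achievesPoA_of_smooth {share : Ω → N → ℝ≥0}
    {M : Mechanism N Ω} {q : (N → ℝ≥0) → N → ℝ≥0} (hq : ∀ i, Measurable fun b => q b i)
    (hq1 : ∀ b i, q b i ≤ 1)
    (hval : ∀ i w b, expValue share M i w b = w * q b i)
    (hpay : ∀ i b, expPayment M i b = b i * q b i) {C : ℝ≥0}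
    (hsm : ∀ v b, opt share v ≤
      C * (∑ i, v i / 2 * q (Function.update b i (v i / 2)) i + 3 * ∑ i, b i * q b i)) :
    AchievesPoA share M (3 * C) := by
  have hsm' : ∀ v b, (opt share v : ℝ≥0∞) ≤
      C * (∑ i, ((v i / 2 * q (Function.update b i (v i / 2)) i : ℝ≥0) : ℝ≥0∞)
        + 3 * ∑ i, ((b i * q b i : ℝ≥0) : ℝ≥0∞)) := by
    intro v b
    have := ENNReal.coe_le_coe.2 (hsm v b)
    push_cast at this ⊢
    exact this
  have hdevm : ∀ (i : N) (w : ℝ≥0), Measurable fun b : N → ℝ≥0 =>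
      ((w / 2 * q (Function.update b i (w / 2)) i : ℝ≥0) : ℝ≥0∞) := by
    intro i w
    have := hq i
    have hu : Measurable fun b : N → ℝ≥0 => Function.update b i (w / 2) := by fun_prop
    have := this.comp hu
    simp only [Function.comp_def] at this
    fun_prop
  have hpaym : ∀ i : N, Measurable fun b : N → ℝ≥0 => ((b i * q b i : ℝ≥0) : ℝ≥0∞) := by
    intro i
    have := hq i
    fun_prop
  have hvalm : ∀ (i : N) (w : ℝ≥0), Measurable fun b : N → ℝ≥0 => ((w * q b i : ℝ≥0) : ℝ≥0∞) := by
    intro i w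
    have := hq i
    fun_prop
  have hcc : ∀ (v : N → ℝ≥0) (μ : ProbabilityMeasure (N → ℝ≥0)), IsCoarseCorrelated share M v μ →
      (opt share v : ℝ≥0∞) / ∫⁻ b, (expWelfare share M v b : ℝ≥0∞) ∂(μ : Measure (N → ℝ≥0))
        ≤ 3 * C := by
    intro v μ h
    refine ENNReal.div_le_of_le_mul ?_
    have hW : ∫⁻ b, (expWelfare share M v b : ℝ≥0∞) ∂(μ : Measure (N → ℝ≥0))
        = ∑ i, ∫⁻ b, ((v i * q b i : ℝ≥0) : ℝ≥0∞) ∂(μ : Measure (N → ℝ≥0)) := by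
      rw [← lintegral_finsetSum _ fun i _ => hvalm i (v i)]
      simp [expWelfare_eq_sum hval]
    rw [hW]
    refine le_of_smooth_of_deviation ?_
      fun i => lintegral_half_add_payment_le hq hq1 hval hpay (h i)
    calc (opt share v : ℝ≥0∞) = ∫⁻ _, (opt share v : ℝ≥0∞) ∂(μ : Measure (N → ℝ≥0)) := by simp
      _ ≤ _ := lintegral_mono fun b => hsm' v b
      _ = _ := by
        rw [lintegral_const_mul' _ _ ENNReal.coe_ne_top, lintegral_add_left,
          lintegral_const_mul' _ _ (by norm_num), lintegral_finsetSum _ fun i _ => hdevm i (v i),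
          lintegral_finsetSum _ fun i _ => hpaym i]
        exact Finset.measurable_sum _ fun i _ => hdevm i (v i)
  refine ⟨?_, ?_, ?_⟩
  · refine iSup_le fun v => iSup_le fun σ => iSup_le fun h => ?_
    exact hcc v ⟨Measure.pi fun j => (σ j : Measure ℝ≥0), inferInstance⟩ h
  · refine iSup_le fun D => iSup_le fun s => iSup_le fun h => ?_
    obtain ⟨hs, h⟩ := h
    refine ENNReal.div_le_of_le_mul ?_
    have hjoint : ∀ i : N, Measurable (Function.uncurry fun (t : ℝ≥0) (b : N → ℝ≥0) =>
        ((t * q b i : ℝ≥0) : ℝ≥0∞)) := by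
      intro i
      have h1 : Measurable fun p : ℝ≥0 × (N → ℝ≥0) => q p.2 i := (hq i).comp measurable_snd
      simp only [Function.uncurry_def]
      fun_prop
    have hpjoint : ∀ i : N, Measurable (Function.uncurry fun (_ : ℝ≥0) (b : N → ℝ≥0) =>
        ((b i * q b i : ℝ≥0) : ℝ≥0∞)) := fun i => (hpaym i).comp measurable_snd
    have hdjoint : ∀ i : N, Measurable (Function.uncurry fun (t : ℝ≥0) (b : N → ℝ≥0) =>
        ((t / 2 * q (Function.update b i (t / 2)) i : ℝ≥0) : ℝ≥0∞)) := by
      intro i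
      have h0 : Measurable fun p : ℝ≥0 × (N → ℝ≥0) => (p.1 / 2, p.2) := by fun_prop
      have h1 := (hq i).comp ((measurable_update_prod i).comp h0)
      simp only [Function.comp_def] at h1
      simp only [Function.uncurry_def]
      fun_prop
    set B : Measure (N → ℝ≥0) := Measure.pi fun j => (D j : Measure ℝ≥0).bind (s j) with hBdef
    have hB : IsProbabilityMeasure B := by rw [hBdef]; infer_instance
    have hvm : Measurable fun y : N → ℝ≥0 × ℝ≥0 => (fun j => (y j).2 : N → ℝ≥0) :=
      measurable_pi_iff.2 fun j => by fun_prop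
    have hsnd := map_snd_valuesAndBids D s
    rw [← hBdef] at hsnd
    have hW : ∫⁻ y, (expWelfare share M (fun i => (y i).1) (fun i => (y i).2) : ℝ≥0∞)
        ∂(valuesAndBids D s)
        = ∑ i, ∫⁻ y, (((y i).1 * q (fun j => (y j).2) i : ℝ≥0) : ℝ≥0∞) ∂(valuesAndBids D s) := by
      rw [← lintegral_finsetSum _ fun i _ => ?_]
      · simp [expWelfare_eq_sum hval]
      · exact (hjoint i).comp (Measurable.prodMk (by fun_prop) hvm)
    rw [hW]
    refine le_of_smooth_of_deviation
      (Dev := fun i => ∫⁻ t, ∫⁻ b, ((t / 2 * q (Function.update b i (t / 2)) i : ℝ≥0) : ℝ≥0∞) ∂B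
        ∂(D i : Measure ℝ≥0))
      (Pay := fun i => ∫⁻ b, ((b i * q b i : ℝ≥0) : ℝ≥0∞) ∂B) ?_ ?_
    · calc ∫⁻ v, (opt share v : ℝ≥0∞) ∂(Measure.pi fun j => (D j : Measure ℝ≥0))
          = ∫⁻ v, ∫⁻ _, (opt share v : ℝ≥0∞) ∂B ∂(Measure.pi fun j => (D j : Measure ℝ≥0)) := by
            simp
        _ ≤ _ := lintegral_mono fun v => lintegral_mono fun b => hsm' v b
        _ = ∫⁻ v, C * (∑ i, ∫⁻ b, ((v i / 2 * q (Function.update b i (v i / 2)) i : ℝ≥0) : ℝ≥0∞) ∂B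
            + 3 * ∑ i, ∫⁻ b, ((b i * q b i : ℝ≥0) : ℝ≥0∞) ∂B)
            ∂(Measure.pi fun j => (D j : Measure ℝ≥0)) := by
          refine lintegral_congr fun v => ?_
          rw [lintegral_const_mul' _ _ ENNReal.coe_ne_top, lintegral_add_left,
            lintegral_const_mul' _ _ (by norm_num), lintegral_finsetSum _ fun i _ => hdevm i (v i),
            lintegral_finsetSum _ fun i _ => hpaym i]
          exact Finset.measurable_sum _ fun i _ => hdevm i (v i)
        _ = _ := by
          rw [lintegral_const_mul' _ _ ENNReal.coe_ne_top, lintegral_add_right _ measurable_const,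
            lintegral_finsetSum]
          · simp only [lintegral_const, measure_univ, mul_one]
            congr 3 with i
            exact (measurePreserving_eval (fun j => (D j : Measure ℝ≥0)) i).lintegral_comp
              (f := fun t => ∫⁻ b, ((t / 2 * q (Function.update b i (t / 2)) i : ℝ≥0) : ℝ≥0∞) ∂B)
              (hdjoint i).lintegral_prod_right'
          · intro i _
            exact (hdjoint i).lintegral_prod_right'.comp (measurable_pi_apply i)
    · intro i
      have hP : ∫⁻ b, ((b i * q b i : ℝ≥0) : ℝ≥0∞) ∂B
          = ∫⁻ t, ∫⁻ b, ((b i * q b i : ℝ≥0) : ℝ≥0∞) ∂(interimBids D s i t)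
            ∂(D i : Measure ℝ≥0) := by
        rw [lintegral_interimBids D s i (hpjoint i), ← hsnd, lintegral_map (hpaym i) hvm]
      rw [hP, ← lintegral_add_left (by exact (hdjoint i).lintegral_prod_right'),
        ← lintegral_interimBids D s i (hjoint i)]
      refine lintegral_mono_ae ?_
      filter_upwards [h i] with t ht
      have : ∀ j, IsProbabilityMeasure
          (Function.update (fun j => (D j : Measure ℝ≥0).bind (s j)) i (s i t) j) := by
        intro j
        by_cases hj : j = i
        · subst hj; simp only [Function.update_self]; infer_instance
        · simp only [Function.update_of_ne hj]; infer_instance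
      have : IsProbabilityMeasure (interimBids D s i t) := by unfold interimBids; infer_instance
      have h2 := lintegral_half_add_payment_le hq hq1 hval hpay ht
      have h3 := lintegral_interimBids_update D s i t (t / 2)
        (G := fun b => ((t / 2 * q b i : ℝ≥0) : ℝ≥0∞)) (by have := hq i; fun_prop)
      rw [h3] at h2
      exact h2
  · refine iSup_le fun v => iSup_le fun μ => iSup_le fun h => ?_
    exact hcc v μ h

end PriceOfAnarchy

/-! ### Relaxations and oblivious rounding -/

section Rounding

variable {N Ω Ω' : Type*} [Fintype N]

lemma welfare_le_opt [Finite Ω] (share : Ω → N → ℝ≥0) (v : N → ℝ≥0) (x : Ω) :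
    welfare share v x ≤ opt share v :=
  le_ciSup (Set.finite_range fun x => welfare share v x).bddAbove x

lemma exists_welfare_eq_opt [Finite Ω] [Nonempty Ω] (share : Ω → N → ℝ≥0) (v : N → ℝ≥0) :
    ∃ x, welfare share v x = opt share v :=
  exists_eq_ciSup_of_finite

lemma opt_le_opt_of_isRelaxation [Finite Ω'] {share : Ω → N → ℝ≥0} {share' : Ω' → N → ℝ≥0}
    (h : IsRelaxation share share') (v : N → ℝ≥0) : opt share v ≤ opt share' v := by
  obtain ⟨ι, -, hι⟩ := h
  rcases isEmpty_or_nonempty Ω with hΩ | hΩ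
  · simp [opt]
  · refine ciSup_le fun x => ?_
    have : welfare share v x = welfare share' v (ι x) := by simp [welfare, hι]
    exact this ▸ welfare_le_opt share' v (ι x)

/-- The maximizer depends on the bids only through the finite table of comparisons between the
welfares of the outcomes. -/
lemma exists_isExactMaximizer [Finite Ω'] [Nonempty Ω'] (share' : Ω' → N → ℝ≥0) :
    ∃ f' : (N → ℝ≥0) → Ω', IsExactMaximizer share' f' := by
  have hw : ∀ x, Measurable fun b : N → ℝ≥0 => welfare share' b x := by
    intro x
    unfold welfare
    fun_prop
  let table : (N → ℝ≥0) → (Ω' × Ω' → Prop) := fun b p =>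
    welfare share' b p.1 ≤ welfare share' b p.2
  have htable : Measurable table :=
    measurable_pi_iff.2 fun p => measurableSet_setOfPred.1 (measurableSet_le (hw p.1) (hw p.2))
  have hmax : ∀ b, ∃ x, ∀ x', table b (x', x) := fun b =>
    Finite.exists_max fun x => welfare share' b x
  classical
  let g : (Ω' × Ω' → Prop) → Ω' := fun T =>
    if h : ∃ x, ∀ x', T (x', x) then h.choose else Classical.arbitrary Ω'
  refine ⟨fun b => g (table b), ?_, fun b x' => ?_⟩
  · let _ : MeasurableSpace Ω' := ⊤
    exact (measurable_of_finite g).comp htable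
  · have : g (table b) = (hmax b).choose := dif_pos (hmax b)
    simp only [this]
    exact (hmax b).choose_spec x'

lemma sum_toNNReal_eq_one [Fintype Ω] (p : PMF Ω) : ∑ x, (p x).toNNReal = 1 := by
  have h := p.tsum_coe
  rw [tsum_fintype] at h
  rw [← ENNReal.toNNReal_sum fun x _ => p.apply_ne_top x, h]
  rfl

lemma sum_toNNReal_pure [Fintype Ω] (y : Ω) (g : Ω → ℝ≥0) :
    ∑ x, (PMF.pure y x).toNNReal * g x = g y := by
  rw [Finset.sum_eq_single y]
  · simp
  · intro x _ hx
    simp [PMF.pure_apply, hx]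
  · simp

/-- The expectation of `g` under the image of a uniform distribution. -/
lemma sum_toNNReal_map_uniform [Fintype Ω] {A : Type*} [Fintype A] [Nonempty A] (T : A → Ω)
    (g : Ω → ℝ≥0) :
    ∑ x, ((PMF.uniformOfFintype A).map T x).toNNReal * g x
      = (Fintype.card A : ℝ≥0)⁻¹ * ∑ a, g (T a) := by
  classical
  have h : ∀ x, ((PMF.uniformOfFintype A).map T x).toNNReal
      = ∑ a, if x = T a then (Fintype.card A : ℝ≥0)⁻¹ else 0 := by
    intro x
    rw [PMF.map_apply, tsum_fintype, ENNReal.toNNReal_sum]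
    · refine Finset.sum_congr rfl fun a _ => ?_
      split_ifs <;> simp
    · intro a _
      split_ifs <;> simp
  simp only [h, Finset.sum_mul, ite_mul, zero_mul]
  rw [Finset.sum_comm]
  simp [Finset.mul_sum]

section

variable [Fintype Ω]

/-- The expected share of player `i` when the relaxed solution `x'` is rounded by `R`. -/
def roundedShare (share : Ω → N → ℝ≥0) (R : Ω' → PMF Ω) (x' : Ω') (i : N) : ℝ≥0 :=
  ∑ x, (R x' x).toNNReal * share x i

/-- A rounding scheme is oblivious exactly if it keeps the share of every single player up to the
factor `α`. -/
lemma isObliviousRounding_iff {share : Ω → N → ℝ≥0} {share' : Ω' → N → ℝ≥0} {α : ℝ≥0}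
    {R : Ω' → PMF Ω} :
    IsObliviousRounding share share' α R ↔
      ∀ x' i, 1 / α * share' x' i ≤ roundedShare share R x' i := by
  classical
  have hsum : ∀ x' (w : N → ℝ≥0), ∑ x, (R x' x).toNNReal * welfare share w x
      = ∑ i, w i * roundedShare share R x' i := by
    intro x' w
    simp only [welfare, roundedShare, Finset.mul_sum]
    rw [Finset.sum_comm]
    exact Finset.sum_congr rfl fun i _ => Finset.sum_congr rfl fun x _ => by ring
  constructor
  · intro h x' i
    have := h x' (Pi.single i 1)
    rw [hsum] at this
    simpa [welfare, Pi.single_apply] using this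
  · intro h x' w
    rw [hsum, welfare, Finset.mul_sum]
    refine Finset.sum_le_sum fun i _ => ?_
    calc 1 / α * (w i * share' x' i) = w i * (1 / α * share' x' i) := by ring
      _ ≤ _ := by gcongr; exact h x' i

variable [DecidableEq N] [Fintype Ω']

/-- Rounding loses the factor `α` in the smoothness inequality, both in the utilities and in the
payments. -/
lemma achievesPoA_roundedMechanism {share : Ω → N → ℝ≥0} {share' : Ω' → N → ℝ≥0}
    (hshare : ∀ x i, share x i ≤ 1) {f' : (N → ℝ≥0) → Ω'} (hf' : IsExactMaximizer share' f')
    {α : ℝ≥0} (hα : α ≠ 0) {R : Ω' → PMF Ω} (hR : IsObliviousRounding share share' α R)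
    {OPT : (N → ℝ≥0) → ℝ≥0} (hOPT : ∀ v, opt share v ≤ OPT v)
    (hsm : SmoothForHalfValue share' (relaxedMechanism share' f') OPT (1 / 2) 3) :
    AchievesPoA share (roundedMechanism share f' R) (3 * (2 * α : ℝ≥0)) := by
  have hx : ∀ x' i, share' x' i ≤ α * roundedShare share R x' i := by
    intro x' i
    have := isObliviousRounding_iff.1 hR x' i
    calc share' x' i = α * (1 / α * share' x' i) := by field_simp
      _ ≤ _ := by gcongr
  refine achievesPoA_of_smooth (q := fun b i => roundedShare share R (f' b) i) ?_ ?_ ?_ ?_ ?_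
  · intro i
    let _ : MeasurableSpace Ω' := ⊤
    exact (measurable_from_top (f := fun x' => roundedShare share R x' i)).comp hf'.1
  · intro b i
    calc _ ≤ ∑ x, (R (f' b) x).toNNReal * 1 := by
          unfold roundedShare; gcongr with x; exact hshare x i
      _ = 1 := by simp [sum_toNNReal_eq_one]
  · intro i w b
    simp only [expValue, roundedMechanism, payYourBid, roundedShare, Finset.mul_sum]
    exact Finset.sum_congr rfl fun x _ => by ring
  · intro i b
    simp only [expPayment, roundedMechanism, payYourBid, roundedShare, Finset.mul_sum]
    exact Finset.sum_congr rfl fun x _ => by ring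
  · intro v b
    have h := hsm v b
    have hpay : ∀ i b, expPayment (relaxedMechanism share' f') i b = b i * share' (f' b) i :=
      fun i b => sum_toNNReal_pure _ _
    have hval : ∀ i w b, expValue share' (relaxedMechanism share' f') i w b
        = w * share' (f' b) i := fun i w b => sum_toNNReal_pure _ _
    simp only [utility, hpay, hval, Function.update_self] at h
    have h1 : ∀ i, ((v i * share' (f' (Function.update b i (v i / 2))) i : ℝ≥0) : ℝ)
        - ((v i / 2 * share' (f' (Function.update b i (v i / 2))) i : ℝ≥0) : ℝ)
        ≤ α * ((v i / 2 *
          roundedShare share R (f' (Function.update b i (v i / 2))) i : ℝ≥0) : ℝ) := by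
      intro i
      have := NNReal.coe_le_coe.2 (hx (f' (Function.update b i (v i / 2))) i)
      push_cast at this ⊢
      have hv : 0 ≤ (v i : ℝ) := (v i).2
      nlinarith
    have h2 : ∀ i, ((b i * share' (f' b) i : ℝ≥0) : ℝ)
        ≤ α * ((b i * roundedShare share R (f' b) i : ℝ≥0) : ℝ) := by
      intro i
      have := NNReal.coe_le_coe.2 (hx (f' b) i)
      push_cast at this ⊢
      have hb : 0 ≤ (b i : ℝ) := (b i).2
      nlinarith
    have h3 := Finset.sum_le_sum fun i (_ : i ∈ Finset.univ) => h1 i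
    have h4 := Finset.sum_le_sum fun i (_ : i ∈ Finset.univ) => h2 i
    rw [← Finset.mul_sum] at h3 h4
    have h5 := NNReal.coe_le_coe.2 (hOPT v)
    rw [← NNReal.coe_le_coe]
    push_cast at *
    linarith

end

/-- Smoothness from exchanges. Let `x` be optimal for the bids `b`, and let `x₀` be an outcome of
the benchmark. If every player `e` with a share in `x₀` can be given a full share at a loss of at
most `L e` of the declared welfare of the others and `e` herself, then a bid `v e / 2` buys her
at least `v e / 2 - L e`: otherwise the mechanism would prefer the exchange. -/
lemma smoothForHalfValue_of_exchange [DecidableEq N] [Fintype Ω'] [Nonempty Ω] [Finite Ω]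
    {share : Ω → N → ℝ≥0}
    {share' : Ω' → N → ℝ≥0} (hshare : ∀ x i, share x i ≤ 1)
    {f' : (N → ℝ≥0) → Ω'} (hf' : IsExactMaximizer share' f')
    (hex : ∀ (x₀ : Ω) (x : Ω') (b : N → ℝ≥0), ∃ L : N → ℝ≥0,
      (∀ e, share x₀ e ≠ 0 → ∃ z, 1 ≤ share' z e ∧
        welfare share' b x ≤ welfare share' (Function.update b e 0) z + L e) ∧
      ∑ e, share x₀ e * L e ≤ 3 * welfare share' b x) :
    SmoothForHalfValue share' (relaxedMechanism share' f') (opt share) (1 / 2) 3 := by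
  intro v b
  have hpay : ∀ i b, expPayment (relaxedMechanism share' f') i b = b i * share' (f' b) i :=
    fun i b => sum_toNNReal_pure _ _
  have hval : ∀ i w b, expValue share' (relaxedMechanism share' f') i w b
      = w * share' (f' b) i := fun i w b => sum_toNNReal_pure _ _
  obtain ⟨x₀, hx₀⟩ := exists_welfare_eq_opt share v
  obtain ⟨L, hL, hL3⟩ := hex x₀ (f' b) b
  have hupd : ∀ (e : N) (t : ℝ≥0) (y : Ω'), welfare share' (Function.update b e t) y
      = t * share' y e + welfare share' (Function.update b e 0) y := by
    intro e t y
    simp only [welfare]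
    rw [← Finset.add_sum_erase _ _ (Finset.mem_univ e),
      ← Finset.add_sum_erase Finset.univ (fun i => Function.update b e 0 i * share' y i)
        (Finset.mem_univ e)]
    simp only [Function.update_self, zero_mul, zero_add]
    congr 1
    refine Finset.sum_congr rfl fun i hi => ?_
    rw [Function.update_of_ne (Finset.ne_of_mem_erase hi),
      Function.update_of_ne (Finset.ne_of_mem_erase hi)]
  have hdev : ∀ e, share x₀ e * (v e / 2) ≤
      v e / 2 * share' (f' (Function.update b e (v e / 2))) e + share x₀ e * L e := by
    intro e
    by_cases he : share x₀ e = 0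
    · simp [he]
    obtain ⟨z, hz1, hz⟩ := hL e he
    set y := f' (Function.update b e (v e / 2)) with hy
    have h1 := hf'.2 (Function.update b e (v e / 2)) z
    rw [← hy, hupd e _ z, hupd e _ y] at h1
    have h2 : welfare share' (Function.update b e 0) y ≤ welfare share' b y := by
      refine Finset.sum_le_sum fun i _ => ?_
      by_cases hi : i = e
      · subst hi; simp
      · rw [Function.update_of_ne hi]
    have h3 := hf'.2 b y
    have h4 : v e / 2 ≤ v e / 2 * share' z e := le_mul_of_one_le_right' hz1
    have h5 : v e / 2 ≤ v e / 2 * share' y e + L e := by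
      rw [← NNReal.coe_le_coe] at *
      push_cast at *
      linarith
    calc share x₀ e * (v e / 2) ≤ share x₀ e * (v e / 2 * share' y e + L e) := by gcongr
      _ = share x₀ e * (v e / 2 * share' y e) + share x₀ e * L e := by ring
      _ ≤ _ := by exact add_le_add (mul_le_of_le_one_left' (hshare _ _)) le_rfl
  have hsum := Finset.sum_le_sum fun e (_ : e ∈ Finset.univ) => hdev e
  rw [Finset.sum_add_distrib] at hsum
  have hopt : ∑ e, share x₀ e * (v e / 2) = opt share v / 2 := by
    rw [← hx₀, welfare, Finset.sum_div]
    exact Finset.sum_congr rfl fun e _ => by ring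
  rw [hopt] at hsum
  have htot := hsum.trans (add_le_add_right hL3 _)
  simp only [utility, hpay, hval, Function.update_self]
  rw [← NNReal.coe_le_coe] at htot
  rw [welfare] at htot
  push_cast at htot ⊢
  have hhalf : ∀ e, (v e : ℝ) * (share' (f' (Function.update b e (v e / 2))) e : ℝ)
      - (v e : ℝ) / 2 * (share' (f' (Function.update b e (v e / 2))) e : ℝ)
      = (v e : ℝ) / 2 * (share' (f' (Function.update b e (v e / 2))) e : ℝ) := fun e => by ring
  simp only [hhalf]
  linarith

end Rounding

/-! ### Tours from permutations: merging cycles -/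

section Merging

open Equiv Equiv.Perm

variable {V : Type*} [Finite V]

/-- Multiplication by a transposition that meets two cycles merges them. -/
lemma sameCycle_mul_swap [DecidableEq V] {σ : Perm V} {a b : V} (hab : ¬ σ.SameCycle a b) :
    (σ * swap a b).SameCycle a b := by
  by_contra hcon
  set τ := σ * swap a b with hτ
  have hτb : τ b = σ a := by simp [hτ]
  -- Otherwise all the points that precede `a` in its old cycle stay in the new cycle of `a`.
  have key : ∀ n : ℕ, τ.SameCycle a ((σ⁻¹ ^ n) a) := by
    intro n
    induction n with
    | zero => exact SameCycle.refl _ _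
    | succ n ih =>
      set x := (σ⁻¹ ^ n) a with hx
      have hx' : (σ⁻¹ ^ (n + 1)) a = σ⁻¹ x := by rw [pow_succ', Perm.mul_apply]
      rw [hx']
      set y := σ⁻¹ x with hy
      have hxy : σ y = x := by simp [hy]
      have hay : σ.SameCycle a y := sameCycle_inv.1 ⟨(n + 1 : ℕ), by rw [zpow_natCast, hx']⟩
      by_cases h1 : y = a
      · rw [h1]
      · have h2 : y ≠ b := fun h => hab (h ▸ hay)
        have : τ y = x := by
          rw [hτ, Perm.mul_apply, swap_apply_of_ne_of_ne h1 h2, hxy]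
        rw [← this] at ih
        exact (sameCycle_apply_right).1 ih
  have h1 : (σ⁻¹).SameCycle a (σ a) := by
    rw [sameCycle_inv]
    exact sameCycle_apply_right.2 (SameCycle.refl _ _)
  obtain ⟨n, hn⟩ := h1.exists_nat_pow_eq
  have h2 := key n
  rw [hn, ← hτb] at h2
  exact hcon (sameCycle_apply_right.1 h2)

lemma SameCycle.mul_swap [DecidableEq V] {σ : Perm V} {a b x y : V} (hab : ¬ σ.SameCycle a b)
    (hxy : σ.SameCycle x y) : (σ * swap a b).SameCycle x y := by
  have hm := sameCycle_mul_swap hab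
  have hstep : ∀ x, (σ * swap a b).SameCycle x (σ x) := by
    intro x
    by_cases h1 : x = a
    · subst h1
      have : σ x = (σ * swap x b) b := by simp
      rw [this]
      exact sameCycle_apply_right.2 hm
    by_cases h2 : x = b
    · subst h2
      have : σ x = (σ * swap a x) a := by simp
      rw [this]
      exact sameCycle_apply_right.2 hm.symm
    have : σ x = (σ * swap a b) x := by simp [swap_apply_of_ne_of_ne h1 h2]
    rw [this]
    exact sameCycle_apply_right.2 (SameCycle.refl _ _)
  obtain ⟨n, rfl⟩ := hxy.exists_nat_pow_eq
  induction n with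
  | zero => exact SameCycle.refl _ _
  | succ n ih =>
    rw [pow_succ', Perm.mul_apply]
    exact (ih ⟨n, by simp⟩).trans (hstep _)

end Merging

section Tours

open Equiv Equiv.Perm

variable {V : Type*} [Fintype V] [DecidableEq V]

/-- If a set `R` meets every cycle of a permutation (including its fixed points), then the
permutation can be changed on `R` to become a tour: among all permutations with the same
properties, one whose cycle through a given vertex is as large as possible is a tour. -/
lemma exists_tour_eq_off (hV : 2 ≤ Fintype.card V) (σ : Perm V) (R : Set V)
    (hR : ∀ x, ∃ y ∈ R, σ.SameCycle x y) : ∃ τ : Tour V, ∀ u ∉ R, τ.1 u = σ u := by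
  classical
  let P : Type _ := {τ : Perm V // (∀ u ∉ R, τ u = σ u) ∧ ∀ x, ∃ y ∈ R, τ.SameCycle x y}
  have : Nontrivial V := Fintype.one_lt_card_iff_nontrivial.1 hV
  have : Nonempty P := ⟨⟨σ, fun _ _ => rfl, hR⟩⟩
  obtain ⟨x₀⟩ : Nonempty V := inferInstance
  obtain ⟨a, ha, -⟩ := hR x₀
  obtain ⟨⟨τ, hτσ, hτR⟩, hmax⟩ := Finite.exists_max fun τ : P =>
    (Finset.univ.filter fun x => τ.1.SameCycle a x).card
  have hall : ∀ y, τ.SameCycle a y := by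
    intro y
    by_contra hy
    obtain ⟨b, hb, hyb⟩ := hτR y
    have hab : ¬ τ.SameCycle a b := fun h => hy (h.trans hyb.symm)
    have h := hmax ⟨τ * swap a b, ?_, ?_⟩
    · refine absurd h (not_le.2 (Finset.card_lt_card ?_))
      refine Finset.ssubset_iff_of_subset ?_ |>.2 ⟨b, ?_, ?_⟩
      · intro x hx
        simp only [Finset.mem_filter, Finset.mem_univ, true_and] at hx ⊢
        exact SameCycle.mul_swap hab hx
      · simpa using sameCycle_mul_swap hab
      · simpa using hab
    · intro u hu
      have h1 : u ≠ a := fun h => hu (h ▸ ha)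
      have h2 : u ≠ b := fun h => hu (h ▸ hb)
      rw [Perm.mul_apply, swap_apply_of_ne_of_ne h1 h2, hτσ u hu]
    · intro x
      obtain ⟨y, hy, hxy⟩ := hτR x
      exact ⟨y, hy, SameCycle.mul_swap hab hxy⟩
  have hmove : ∀ x, τ x ≠ x := by
    intro x hx
    obtain ⟨y, hy⟩ := exists_ne x
    exact hy.symm (((hall x).symm.trans (hall y)).eq_of_left hx)
  refine ⟨⟨τ, ⟨a, hmove a, fun y _ => hall y⟩, ?_⟩, hτσ⟩
  ext x
  simp [hmove x]

lemma nonempty_tour (hV : 2 ≤ Fintype.card V) : Nonempty (Tour V) := by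
  obtain ⟨τ, -⟩ := exists_tour_eq_off hV 1 Set.univ fun x => ⟨x, trivial, SameCycle.refl _ _⟩
  exact ⟨τ⟩

lemma Tour.apply_ne (τ : Tour V) (u : V) : τ.1 u ≠ u := by
  rw [← mem_support, τ.2.2]
  exact Finset.mem_univ u

lemma tourShare_le_one (τ : Tour V) (e : Edge V) : tourShare τ e ≤ 1 := by
  unfold tourShare; split_ifs <;> simp

lemma coverShare_le_one {V : Type*} [DecidableEq V] (σ : CycleCover V) (e : Edge V) :
    coverShare σ e ≤ 1 := by
  unfold coverShare; split_ifs <;> simp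

lemma sum_insert_le {X : Type*} [DecidableEq X] (x : X) (s : Finset X) (c : X → ℝ≥0) :
    ∑ y ∈ insert x s, c y ≤ c x + ∑ y ∈ s, c y := by
  by_cases hx : x ∈ s
  · rw [Finset.insert_eq_of_mem hx]
    exact le_add_of_nonneg_left zero_le
  · rw [Finset.sum_insert hx]

/-- Summing over the edges `(u, f u)` is summing over their sources. -/
lemma sum_ite_src (f : V → V) (hf : ∀ u, f u ≠ u) (G : Edge V → ℝ≥0) :
    ∑ e : Edge V, (if f e.src = e.tgt then G e else 0) = ∑ u, G ⟨(u, f u), (hf u).symm⟩ := by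
  rw [← Finset.sum_filter]
  refine Finset.sum_bij' (fun e _ => e.src) (fun u _ => ⟨(u, f u), (hf u).symm⟩) ?_ ?_ ?_ ?_ ?_
  · simp
  · simp
  · rintro ⟨⟨a, b⟩, hab⟩ h
    simp only [Finset.mem_filter] at h
    simpa using h.2
  · simp
  · rintro ⟨⟨a, b⟩, hab⟩ h
    simp only [Finset.mem_filter, Finset.mem_univ, true_and] at h
    simp only [h]

/-- Summing over the edges `(f u, u)` is summing over their targets. -/
lemma sum_ite_tgt (f : V → V) (hf : ∀ u, f u ≠ u) (G : Edge V → ℝ≥0) :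
    ∑ e : Edge V, (if f e.tgt = e.src then G e else 0) = ∑ u, G ⟨(f u, u), hf u⟩ := by
  rw [← Finset.sum_filter]
  refine Finset.sum_bij' (fun e _ => e.tgt) (fun u _ => ⟨(f u, u), hf u⟩) ?_ ?_ ?_ ?_ ?_
  · simp
  · simp
  · rintro ⟨⟨a, b⟩, hab⟩ h
    simp only [Finset.mem_filter] at h
    simpa using h.2
  · simp
  · rintro ⟨⟨a, b⟩, hab⟩ h
    simp only [Finset.mem_filter, Finset.mem_univ, true_and] at h
    simp only [h]

/-- A quantity attached to the source of an edge, summed over the edges of a tour. -/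
lemma sum_tourShare_src (τ : Tour V) (g : V → ℝ≥0) :
    ∑ e, tourShare τ e * g e.src = ∑ u, g u := by
  have := sum_ite_src τ.1 τ.apply_ne fun e => g e.src
  simpa [tourShare] using this

lemma sum_tourShare_tgt (τ : Tour V) (g : V → ℝ≥0) :
    ∑ e, tourShare τ e * g e.tgt = ∑ u, g u := by
  have := sum_ite_src τ.1 τ.apply_ne fun e => g e.tgt
  rw [show ∑ u, g u = ∑ u, g (τ.1 u) from (Equiv.sum_comp τ.1 g).symm]
  simpa [tourShare] using this

lemma sum_coverShare_src (σ : CycleCover V) (g : V → ℝ≥0) :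
    ∑ e, coverShare σ e * g e.src = ∑ u, g u := by
  have := sum_ite_src σ.1 σ.2 fun e => g e.src
  simpa [coverShare] using this

lemma sum_coverShare_tgt (σ : CycleCover V) (g : V → ℝ≥0) :
    ∑ e, coverShare σ e * g e.tgt = ∑ u, g u := by
  have := sum_ite_src σ.1 σ.2 fun e => g e.tgt
  rw [show ∑ u, g u = ∑ u, g (σ.1 u) from (Equiv.sum_comp σ.1 g).symm]
  simpa [coverShare] using this

lemma welfare_coverShare (b : Edge V → ℝ≥0) (σ : CycleCover V) :
    welfare coverShare b σ = ∑ u, b ⟨(u, σ.1 u), (σ.2 u).symm⟩ := by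
  rw [← sum_ite_src σ.1 σ.2]
  simp [welfare, coverShare]

lemma isRelaxation_coverShare :
    IsRelaxation (N := Edge V) (tourShare (V := V)) (coverShare (V := V)) := by
  refine ⟨fun τ => ⟨τ.1, τ.apply_ne⟩, fun τ τ' h => ?_, fun τ => rfl⟩
  exact Subtype.ext (congrArg (fun σ : CycleCover V => σ.1) h)

/-! ### Cycle covers: exchanges and Fisher's rounding -/

/-- Any edge `(u, w)` can be inserted into a cycle cover at the loss of the edges that leave `u`,
enter `w`, and leave `w`. The last one is needed only if the cover goes from `u` to `w` in two
steps, as then short-cutting would isolate the vertex in between. -/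
lemma exists_cover_exchange {V : Type*} [DecidableEq V] (σ : CycleCover V) {u w : V} (huw : u ≠ w) :
    ∃ z : CycleCover V, z.1 u = w ∧
      ∀ x, x ≠ u → x ≠ σ.1.symm w → x ≠ w → z.1 x = σ.1 x := by
  obtain ⟨σ, hσ⟩ := σ
  have hinj := σ.injective
  by_cases h1 : σ u = w
  · exact ⟨⟨σ, hσ⟩, h1, fun _ _ _ _ => rfl⟩
  obtain ⟨a, rfl⟩ := σ.surjective w
  simp only [symm_apply_apply]
  by_cases h2 : σ u = a
  · refine ⟨⟨σ * (swap u a * swap a (σ a)), fun x => ?_⟩, ?_, ?_⟩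
    · have := hσ u
      have := hσ a
      have := hσ (σ a)
      have := hσ x
      simp only [Perm.mul_apply, swap_apply_def]
      grind
    · simp only [Perm.mul_apply, swap_apply_def]
      have := hσ u
      have := hσ a
      grind
    · intro x hx1 hx2 hx3
      simp only [Perm.mul_apply, swap_apply_def]
      grind
  · refine ⟨⟨σ * swap u a, fun x => ?_⟩, by simp, ?_⟩
    · have := hσ x
      simp only [Perm.mul_apply, swap_apply_def]
      grind
    · intro x hx1 hx2 _
      simp [swap_apply_of_ne_of_ne hx1 hx2]

/-- In total, the exchanges for the edges of a cycle cover charge every edge of the given cover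
three times. -/
lemma smoothForHalfValue_coverShare [Nonempty (CycleCover V)] {f' : (Edge V → ℝ≥0) → CycleCover V}
    (hf' : IsExactMaximizer coverShare f') :
    SmoothForHalfValue coverShare (relaxedMechanism coverShare f') (opt coverShare) (1 / 2) 3 := by
  refine smoothForHalfValue_of_exchange coverShare_le_one hf' fun x₀ σ b => ?_
  let c : V → ℝ≥0 := fun u => b ⟨(u, σ.1 u), (σ.2 u).symm⟩
  refine ⟨fun e => c e.src + c (σ.1.symm e.tgt) + c e.tgt, fun e _ => ?_, ?_⟩
  · obtain ⟨z, hz, hzσ⟩ := exists_cover_exchange σ e.2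
    refine ⟨z, by simp [coverShare, hz], ?_⟩
    rw [welfare_coverShare, welfare_coverShare,
      ← Finset.sum_add_sum_compl {e.src, σ.1.symm e.tgt, e.tgt}, add_comm]
    refine add_le_add ?_ ?_
    · refine le_trans (Finset.sum_le_sum fun x hx => ?_)
        (Finset.sum_le_univ_sum_of_nonneg fun _ => zero_le)
      simp only [Finset.mem_compl, Finset.mem_insert, Finset.mem_singleton, not_or] at hx
      have h := hzσ x hx.1 hx.2.1 hx.2.2
      rw [Function.update_of_ne]
      · simp only [h, le_refl]
      · intro he
        exact hx.1 (congrArg Edge.src he)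
    · refine (sum_insert_le _ _ _).trans ?_
      refine (add_le_add_right (sum_insert_le _ _ _) _).trans_eq ?_
      simp [c, add_assoc]
  · simp only [mul_add, Finset.sum_add_distrib]
    rw [sum_coverShare_src x₀ c, sum_coverShare_tgt x₀ c,
      sum_coverShare_tgt x₀ fun w => c (σ.1.symm w), Equiv.sum_comp σ.1.symm c, welfare_coverShare]
    exact le_of_eq (by ring)

lemma exists_isPatching (hV : 2 ≤ Fintype.card V) :
    ∃ g : (σ : CycleCover V) → Removal σ → Tour V, IsPatching g := by
  have h : ∀ (σ : CycleCover V) (r : Removal σ), ∃ τ : Tour V,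
      ∀ u ∉ Set.range (fun c => (r c : V)), τ.1 u = σ.1 u := by
    intro σ r
    refine exists_tour_eq_off hV σ.1 _ fun x => ?_
    have hx : σ.1.cycleOf x ∈ σ.1.cycleFactorsFinset :=
      cycleOf_mem_cycleFactorsFinset_iff.2 (mem_support.2 (σ.2 x))
    refine ⟨r ⟨_, hx⟩, ⟨⟨_, hx⟩, rfl⟩, ?_⟩
    exact (mem_support_cycleOf_iff.1 (r ⟨_, hx⟩).2).1
  choose g hg using h
  exact ⟨g, fun σ r u hu => hg σ r u (by simpa using hu)⟩

/-- An edge `(u, σ u)` is removed with probability at most one half: replacing the removed edge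
by the next one on the cycle injects the choices that remove it into those that keep it. -/
lemma isObliviousRounding_fisherRounding {g : (σ : CycleCover V) → Removal σ → Tour V}
    (hg : IsPatching g) : IsObliviousRounding tourShare coverShare 2 (fisherRounding g) := by
  rw [isObliviousRounding_iff]
  intro σ e
  unfold coverShare
  split_ifs with he
  swap
  · simp
  unfold roundedShare fisherRounding
  rw [sum_toNNReal_map_uniform]
  set u := e.src
  have hu : σ.1.cycleOf u ∈ σ.1.cycleFactorsFinset :=
    cycleOf_mem_cycleFactorsFinset_iff.2 (mem_support.2 (σ.2 u))
  let c₀ : {c // c ∈ σ.1.cycleFactorsFinset} := ⟨_, hu⟩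
  have hnext : σ.1 u ∈ (σ.1.cycleOf u).support := by
    rw [mem_support_cycleOf_iff]
    exact ⟨sameCycle_apply_right.2 (SameCycle.refl _ _), mem_support.2 (σ.2 u)⟩
  let keep : Finset (Removal σ) := Finset.univ.filter fun r => (r c₀ : V) ≠ u
  have hkeep : ∀ r ∈ keep, tourShare (g σ r) e = 1 := by
    intro r hr
    have hr' : (r c₀ : V) ≠ u := by simpa [keep] using hr
    have : (g σ r).1 u = σ.1 u := by
      refine hg σ r u fun c hc => hr' ?_
      have hcu : u ∈ c.1.support := hc ▸ (r c).2
      have : c = c₀ := Subtype.ext (cycle_is_cycleOf hcu c.2)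
      rw [← this, hc]
    exact if_pos (this.trans he)
  have hcard : Fintype.card (Removal σ) ≤ 2 * keep.card := by
    have h1 : (Finset.univ.filter fun r : Removal σ => ¬ (r c₀ : V) ≠ u).card ≤ keep.card := by
      refine Finset.card_le_card_of_injOn
        (fun r => Function.update r c₀ ⟨σ.1 u, hnext⟩) ?_ ?_
      · intro r _
        simp [keep, σ.2 u]
      · intro r hr r' hr' hrr
        simp only [Finset.coe_filter, Finset.mem_univ, true_and, not_not,
          Set.mem_ofPred_eq] at hr hr'
        funext c
        by_cases hc : c = c₀
        · subst hc; exact Subtype.ext (hr.trans hr'.symm)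
        · have := congrFun hrr c
          simpa [Function.update_of_ne hc] using this
    have h2 := Finset.card_filter_add_card_filter_not (s := Finset.univ)
      (fun r : Removal σ => (r c₀ : V) ≠ u)
    rw [Finset.card_univ] at h2
    simp only [keep] at *
    omega
  have hpos : (0 : ℝ≥0) < Fintype.card (Removal σ) := by
    exact_mod_cast Fintype.card_pos
  have hsum : (keep.card : ℝ≥0) ≤ ∑ r, tourShare (g σ r) e := by
    calc (keep.card : ℝ≥0) = ∑ r ∈ keep, tourShare (g σ r) e := by
          rw [Finset.sum_congr rfl hkeep]; simp
      _ ≤ _ := Finset.sum_le_univ_sum_of_nonneg fun _ => zero_le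
  rw [mul_one, inv_mul_eq_div, le_div_iff₀ hpos, div_mul_eq_mul_div, one_mul]
  rw [div_le_iff₀ (by norm_num)]
  calc (Fintype.card (Removal σ) : ℝ≥0) ≤ ((2 * keep.card : ℕ) : ℝ≥0) := by exact_mod_cast hcard
    _ = keep.card * 2 := by push_cast; ring
    _ ≤ _ := by gcongr

end Tours

/-! ### Half-edge covers as gluings of half-edges -/

section Gluing

open Equiv

/-- A fixed-point free involution that glues the half-edges `(v, true)` (leaving `v`) and
`(v, false)` (entering `v`), two at each vertex, to the edges of a simple graph, which is thus a
disjoint union of undirected cycles of length at least three. -/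
structure IsGluing {V : Type*} (π : Perm (V × Bool)) : Prop where
  /-- Half-edges are glued in pairs. -/
  invol : ∀ h, π (π h) = h
  /-- There are no loops. -/
  ne : ∀ h, (π h).1 ≠ h.1
  /-- There are no parallel edges. -/
  inj : ∀ h h', h.1 = h'.1 → (π h).1 = (π h').1 → h = h'

section

variable {V : Type*} {π : Perm (V × Bool)}

/-- Exchanging the roles of the half-edges at each vertex. -/
lemma IsGluing.conj (hπ : IsGluing π) {θ : Perm (V × Bool)} (hθ : ∀ h, (θ h).1 = h.1) :
    IsGluing (θ⁻¹ * π * θ) := by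
  have hθ' : ∀ h, (θ⁻¹ h).1 = h.1 := fun h => by
    have := hθ (θ⁻¹ h)
    simpa using this.symm
  refine ⟨fun h => by simp [hπ.invol], fun h => ?_, fun h h' h1 h2 => ?_⟩
  · rw [Perm.mul_apply, Perm.mul_apply, hθ', ← hθ h]
    exact hπ.ne _
  · rw [Perm.mul_apply, Perm.mul_apply, Perm.mul_apply, Perm.mul_apply, hθ', hθ'] at h2
    rw [← hθ h, ← hθ h'] at h1
    exact θ.injective (hπ.inj _ _ h1 h2)

variable [DecidableEq V]

/-- Replacing the edges `h₁ — π h₁` and `h₃ — π h₃` by `h₁ — h₃` and `π h₁ — π h₃`. -/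
lemma IsGluing.switch (hπ : IsGluing π) {h₁ h₃ : V × Bool} (hne : h₁.1 ≠ h₃.1)
    (hadj : ∀ h, h.1 = h₁.1 → (π h).1 ≠ h₃.1) (hne' : (π h₁).1 ≠ (π h₃).1)
    (hadj' : ∀ h, h.1 = (π h₁).1 → (π h).1 ≠ (π h₃).1) :
    ∃ π' : Perm (V × Bool), IsGluing π' ∧ π' h₁ = h₃ ∧
      ∀ h, h ≠ h₁ → h ≠ h₃ → h ≠ π h₁ → h ≠ π h₃ → π' h = π h := by
  have hI := hπ.invol
  have hN := hπ.ne
  have hJ := hπ.inj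
  have p2 := hI h₁
  have p4 := hI h₃
  have d12 := hN h₁
  have d34 := hN h₃
  have d23 := hadj h₁ rfl
  have d14 : (π h₃).1 ≠ h₁.1 := fun h => hadj (π h₃) h (by rw [p4])
  have sadj : ∀ h, h.1 = h₃.1 → (π h).1 ≠ h₁.1 := fun h a b => hadj (π h) b (by rw [hI, a])
  have sadj' : ∀ h, h.1 = (π h₃).1 → (π h).1 ≠ (π h₁).1 :=
    fun h a b => hadj' (π h) b (by rw [hI, a])
  generalize p1 : π h₁ = h₂ at *
  generalize p3 : π h₃ = h₄ at *
  have n12 : h₁ ≠ h₂ := fun h => d12 (by rw [h])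
  have n13 : h₁ ≠ h₃ := fun h => hne (by rw [h])
  have n14 : h₁ ≠ h₄ := fun h => d14 (by rw [h])
  have n23 : h₂ ≠ h₃ := fun h => d23 (by rw [h])
  have n24 : h₂ ≠ h₄ := fun h => hne' (by rw [h])
  have n34 : h₃ ≠ h₄ := fun h => d34 (by rw [h])
  have v1 : (swap h₂ h₃ * π * swap h₂ h₃) h₁ = h₃ := by
    simp [swap_apply_of_ne_of_ne n12 n13, p1]
  have v2 : (swap h₂ h₃ * π * swap h₂ h₃) h₂ = h₄ := by
    simp [swap_apply_of_ne_of_ne n24.symm n34.symm, p3]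
  have v3 : (swap h₂ h₃ * π * swap h₂ h₃) h₃ = h₁ := by
    simp [swap_apply_of_ne_of_ne n12 n13, p2]
  have v4 : (swap h₂ h₃ * π * swap h₂ h₃) h₄ = h₂ := by
    simp [swap_apply_of_ne_of_ne n24.symm n34.symm, p4]
  have hoff : ∀ h, h ≠ h₁ → h ≠ h₃ → h ≠ h₂ → h ≠ h₄ →
      (swap h₂ h₃ * π * swap h₂ h₃) h = π h := by
    intro h a1 a2 a3 a4
    rw [Perm.mul_apply, Perm.mul_apply, swap_apply_of_ne_of_ne a3 a2, swap_apply_of_ne_of_ne]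
    · intro h'; exact a1 (by rw [← p2, ← h', hI])
    · intro h'; exact a4 (by rw [← p3, ← h', hI])
  have hcases : ∀ h, h = h₁ ∨ h = h₂ ∨ h = h₃ ∨ h = h₄ ∨
      (swap h₂ h₃ * π * swap h₂ h₃) h = π h := by
    intro h
    have := hoff h
    tauto
  refine ⟨swap h₂ h₃ * π * swap h₂ h₃, ⟨fun h => by simp [hI], fun h => ?_,
    fun h h' hh hh' => ?_⟩, v1, hoff⟩
  · rcases hcases h with rfl | rfl | rfl | rfl | h0
    · rw [v1]; exact hne.symm
    · rw [v2]; exact hne'.symm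
    · rw [v3]; exact hne
    · rw [v4]; exact hne'
    · rw [h0]; exact hN h
  · clear hoff
    generalize swap h₂ h₃ * π * swap h₂ h₃ = π' at *
    have off : ∀ k k', k.1 = k'.1 → (π' k).1 = (π' k').1 → π' k' = π k' →
        (k = h₁ ∨ k = h₂ ∨ k = h₃ ∨ k = h₄) → False := by
      rintro k k' e1 e2 e3 (rfl | rfl | rfl | rfl)
      · rw [e3, v1] at e2; exact hadj k' e1.symm e2.symm
      · rw [e3, v2] at e2; exact hadj' k' e1.symm e2.symm
      · rw [e3, v3] at e2; exact sadj k' e1.symm e2.symm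
      · rw [e3, v4] at e2; exact sadj' k' e1.symm e2.symm
    rcases hcases h' with k' | k' | k' | k' | k'
    · rcases hcases h with k | k | k | k | k
      · rw [k, k']
      · rw [k, k'] at hh; exact absurd hh d12
      · rw [k, k'] at hh; exact absurd hh.symm hne
      · rw [k, k'] at hh; exact absurd hh d14
      · exact (off h' h hh.symm hh'.symm k (by tauto)).elim
    · rcases hcases h with k | k | k | k | k
      · rw [k, k'] at hh; exact absurd hh.symm d12
      · rw [k, k']
      · rw [k, k'] at hh; exact absurd hh.symm d23
      · rw [k, k'] at hh; exact absurd hh.symm hne'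
      · exact (off h' h hh.symm hh'.symm k (by tauto)).elim
    · rcases hcases h with k | k | k | k | k
      · rw [k, k'] at hh; exact absurd hh hne
      · rw [k, k'] at hh; exact absurd hh d23
      · rw [k, k']
      · rw [k, k'] at hh; exact absurd hh d34
      · exact (off h' h hh.symm hh'.symm k (by tauto)).elim
    · rcases hcases h with k | k | k | k | k
      · rw [k, k'] at hh; exact absurd hh.symm d14
      · rw [k, k'] at hh; exact absurd hh hne'
      · rw [k, k'] at hh; exact absurd hh.symm d34
      · rw [k, k']
      · exact (off h' h hh.symm hh'.symm k (by tauto)).elim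
    · rcases hcases h with k | k | k | k | k
      · exact (off h h' hh hh' k' (by tauto)).elim
      · exact (off h h' hh hh' k' (by tauto)).elim
      · exact (off h h' hh hh' k' (by tauto)).elim
      · exact (off h h' hh hh' k' (by tauto)).elim
      · rw [k, k'] at hh'; exact hJ h h' hh hh'

lemma swap_fst (x : V) (k l : Bool) (h : V × Bool) : (swap (x, k) (x, l) h).1 = h.1 := by
  simp only [swap_apply_def]
  grind

/-- An edge between `u` and `w` becomes an outgoing edge of `u` and an ingoing edge of `w` after
the roles of the half-edges at these two vertices are exchanged, if necessary. -/
lemma IsGluing.exists_reorientation (hπ : IsGluing π) {u w : V} (huw : u ≠ w) {i j : Bool}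
    (h : π (u, i) = (w, j)) :
    ∃ π' : Perm (V × Bool), IsGluing π' ∧ π' (u, true) = (w, false) ∧
      ∀ h ∉ ({(u, true), (w, false), (u, i), (w, j)} : Finset (V × Bool)),
        (π' h).1 = (π h).1 := by
  let θ : Perm (V × Bool) := swap (u, true) (u, i) * swap (w, false) (w, j)
  have hθ : ∀ h, (θ h).1 = h.1 := fun h => by simp only [θ, Perm.mul_apply, swap_fst]
  have hθ' : ∀ h, (θ⁻¹ h).1 = h.1 := fun h => by
    have := hθ (θ⁻¹ h)
    simpa using this.symm
  refine ⟨θ⁻¹ * π * θ, hπ.conj hθ, ?_, fun h hh => ?_⟩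
  · have a1 : θ (u, true) = (u, i) := by
      simp only [θ, Perm.mul_apply]
      rw [swap_apply_of_ne_of_ne (a := (w, false)) (by simp [huw]) (by simp [huw]),
        swap_apply_left]
    have a2 : θ (w, false) = (w, j) := by
      simp only [θ, Perm.mul_apply]
      rw [swap_apply_left, swap_apply_of_ne_of_ne] <;> simp [huw.symm]
    rw [Perm.mul_apply, Perm.mul_apply, a1, h, ← a2]
    simp
  · simp only [Finset.mem_insert, Finset.mem_singleton, not_or] at hh
    obtain ⟨n1, n2, n3, n4⟩ := hh
    have a1 : θ h = h := by
      simp only [θ, Perm.mul_apply]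
      rw [swap_apply_of_ne_of_ne n2 n4, swap_apply_of_ne_of_ne n1 n3]
    rw [Perm.mul_apply, Perm.mul_apply, hθ', a1]

/-- If `u` and `w` are not adjacent, then `u`'s outgoing half-edge can be glued to `w`'s ingoing
one after deleting an edge at `u` and an edge at `w`, provided that the other endpoints of these
two edges are distinct and not adjacent. -/
lemma IsGluing.exists_exchange (hπ : IsGluing π) {u w : V} (huw : u ≠ w)
    (hadj : ∀ h, h.1 = u → (π h).1 ≠ w) (i j : Bool)
    (hne' : (π (u, i)).1 ≠ (π (w, j)).1)
    (hadj' : ∀ h, h.1 = (π (u, i)).1 → (π h).1 ≠ (π (w, j)).1) :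
    ∃ π' : Perm (V × Bool), IsGluing π' ∧ π' (u, true) = (w, false) ∧
      ∀ h ∉ ({(u, true), (w, false), (u, i), π (u, i), (w, j), π (w, j)} : Finset (V × Bool)),
        (π' h).1 = (π h).1 := by
  obtain ⟨π₁, h1, h2, h3⟩ := hπ.switch (h₁ := (u, i)) (h₃ := (w, j)) huw hadj hne' hadj'
  obtain ⟨π₂, k1, k2, k3⟩ := h1.exists_reorientation huw h2
  refine ⟨π₂, k1, k2, fun h hh => ?_⟩
  simp only [Finset.mem_insert, Finset.mem_singleton, not_or] at hh k3
  obtain ⟨n1, n2, n3, n4, n5, n6⟩ := hh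
  rw [k3 h ⟨n1, n2, n3, n5⟩, h3 h n3 n5 n4 n6]

/-- The loss of weight from inserting the edge `(u, w)` into a half-edge cover, where the
half-edge `h` has weight `c h`: the halves at `u` and at the other end of its outgoing edge, the
halves at `w` and at the other end of its ingoing edge, and the average of what is lost in
addition if the outgoing edge of `w`, respectively the ingoing edge of `u`, has to be deleted. -/
noncomputable def exchangeLoss (π : Perm (V × Bool)) (c : V × Bool → ℝ≥0) (u w : V) : ℝ≥0 :=
  (c (u, true) + c (π (u, true)) + (c (u, false) + c (π (u, false))) / 2)
    + (c (w, false) + c (π (w, false)) + (c (w, true) + c (π (w, true))) / 2)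

lemma sum_le_sum_map_list {X : Type*} [DecidableEq X] (c : X → ℝ≥0) (l : List X) :
    ∀ S : Finset X, (∀ x ∈ S, x ∈ l) → ∑ x ∈ S, c x ≤ (l.map c).sum := by
  intro S hS
  refine (Finset.sum_le_sum_of_subset (t := l.toFinset) fun x hx => by simpa using hS x hx).trans ?_
  clear hS
  induction l with
  | nil => simp
  | cons a l ih =>
    rw [List.toFinset_cons, List.map_cons, List.sum_cons]
    exact (sum_insert_le _ _ _).trans (by gcongr)

/-- If the edges at `x` and `y` cannot be exchanged, because their other endpoints coincide or are
adjacent, then those at `x` and at the other half-edge `y'` of the vertex of `y` can. -/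
lemma IsGluing.exchangeable_of_not {V : Type*} {π : Perm (V × Bool)} (hπ : IsGluing π)
    {x y y' : V × Bool} (hxy : x.1 ≠ y.1)
    (hy : y'.1 = y.1) (hyy : y' ≠ y) (hadj : ∀ h, h.1 = x.1 → (π h).1 ≠ y.1)
    (hnot : (π x).1 = (π y).1 ∨ ∃ k, k.1 = (π x).1 ∧ (π k).1 = (π y).1) :
    (π x).1 ≠ (π y').1 ∧ ∀ h, h.1 = (π x).1 → (π h).1 ≠ (π y').1 := by
  have hI := hπ.invol
  have two : ∀ a b c : V × Bool, a.1 = c.1 → b.1 = c.1 → a ≠ b → c = a ∨ c = b := by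
    rintro ⟨v, i⟩ ⟨v', j⟩ ⟨v'', k⟩ rfl h2 h3
    cases i <;> cases j <;> cases k <;> simp_all
  have hadj' : ∀ h, h.1 = y.1 → (π h).1 ≠ x.1 := fun h a b => hadj (π h) b (by rw [hI, a])
  rcases hnot with hnot | ⟨k, hk1, hk2⟩
  · refine ⟨fun h => hyy (hπ.inj _ _ hy (h.symm.trans hnot)), fun h h1 h2 => ?_⟩
    rcases two (π x) (π y) h h1.symm (hnot.symm.trans h1.symm)
      (fun e => hxy (by rw [π.injective e])) with rfl | rfl
    · rw [hI] at h2; exact hadj' y' hy h2.symm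
    · rw [hI] at h2; exact hπ.ne y' (by rw [← h2, hy])
  · have hkx : k ≠ π x := fun e => by
      rw [e, hI] at hk2; exact hadj' y rfl hk2.symm
    refine ⟨fun h => ?_, fun h h1 h2 => ?_⟩
    · rcases two (π x) k (π y') h (hk1.trans h) hkx.symm with e | e
      · exact hxy (by rw [← hy, π.injective e])
      · rw [← e, hI, hy] at hk2; exact hπ.ne y hk2.symm
    · rcases two (π x) k h h1.symm (hk1.trans h1.symm) hkx.symm with rfl | rfl
      · rw [hI] at h2; exact hadj' y' hy h2.symm
      · exact hyy (hπ.inj _ _ hy (h2.symm.trans hk2))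

/-- Every edge `(u, w)` can be inserted into a half-edge cover. If `u` and `w` are adjacent, it is
enough to exchange roles of half-edges at `u` and `w`. Otherwise, if the other endpoints `a` of the
outgoing edge of `u` and `c` of the ingoing edge of `w` are distinct and not adjacent, these two
edges are replaced by `uw` and `ac`. Else one deletes, together with one of these edges, the
other edge of the other vertex; there are two ways to do so, and the better one is at least as good
as their average. -/
lemma IsGluing.exists_exchange_le (hπ : IsGluing π) {u w : V} (huw : u ≠ w)
    (c : V × Bool → ℝ≥0) :
    ∃ (π' : Perm (V × Bool)) (S : Finset (V × Bool)), IsGluing π' ∧ π' (u, true) = (w, false) ∧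
      (u, true) ∈ S ∧ (w, false) ∈ S ∧ (∀ h ∉ S, (π' h).1 = (π h).1) ∧
      ∑ h ∈ S, c h ≤ exchangeLoss π c u w := by
  have hI := hπ.invol
  by_cases hadj : ∃ i j, π (u, i) = (w, j)
  · obtain ⟨i, j, hij⟩ := hadj
    have hji : π (w, j) = (u, i) := by rw [← hij, hI]
    obtain ⟨π', h1, h2, h3⟩ := hπ.exists_reorientation huw hij
    refine ⟨π', _, h1, h2, by simp, by simp, h3, ?_⟩
    unfold exchangeLoss
    have hl := fun l => sum_le_sum_map_list c l
      ({(u, true), (w, false), (u, i), (w, j)} : Finset (V × Bool))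
    cases i <;> cases j
    · refine (hl [(u, true), (w, false), (u, false)] (by simp)).trans ?_
      rw [hij, hji, ← NNReal.coe_le_coe]
      simp
      have := (c (π (u, true))).2
      have := (c (π (w, true))).2
      have := (c (w, true)).2
      linarith
    · refine (hl [(u, true), (w, false), (u, false), (w, true)] (by simp)).trans ?_
      rw [hij, hji, ← NNReal.coe_le_coe]
      simp
      have := (c (π (u, true))).2
      have := (c (π (w, false))).2
      linarith
    · refine (hl [(u, true), (w, false)] (by simp)).trans ?_
      rw [hij, hji, ← NNReal.coe_le_coe]
      simp
      have := (c (u, false)).2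
      have := (c (w, true)).2
      have := (c (π (u, false))).2
      have := (c (π (w, true))).2
      have := (c (u, true)).2
      have := (c (w, false)).2
      linarith
    · refine (hl [(u, true), (w, false), (w, true)] (by simp)).trans ?_
      rw [hij, hji, ← NNReal.coe_le_coe]
      simp
      have := (c (π (w, false))).2
      have := (c (π (u, false))).2
      have := (c (u, false)).2
      linarith
  · have hadj : ∀ h : V × Bool, h.1 = u → (π h).1 ≠ w := by
      rintro ⟨v, i⟩ rfl hw
      exact hadj ⟨i, (π (v, i)).2, Prod.ext hw rfl⟩
    have hadj' : ∀ h : V × Bool, h.1 = w → (π h).1 ≠ u :=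
      fun h a b => hadj (π h) b (by rw [hI, a])
    by_cases hgen : (π (u, true)).1 ≠ (π (w, false)).1 ∧
        ∀ h, h.1 = (π (u, true)).1 → (π h).1 ≠ (π (w, false)).1
    · obtain ⟨π', h1, h2, h3⟩ := hπ.exists_exchange huw hadj true false hgen.1 hgen.2
      refine ⟨π', _, h1, h2, by simp, by simp, h3, ?_⟩
      refine (sum_le_sum_map_list c [(u, true), (w, false), π (u, true), π (w, false)] _
        (by simp)).trans ?_
      unfold exchangeLoss
      rw [← NNReal.coe_le_coe]
      simp
      have := (c (π (u, false))).2
      have := (c (u, false)).2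
      have := (c (π (w, true))).2
      have := (c (w, true)).2
      linarith
    have hnot : (π (u, true)).1 = (π (w, false)).1 ∨
        ∃ k, k.1 = (π (u, true)).1 ∧ (π k).1 = (π (w, false)).1 := by
      by_contra hcon
      push Not at hcon
      exact hgen hcon
    have hnot' : (π (w, false)).1 = (π (u, true)).1 ∨
        ∃ k, k.1 = (π (w, false)).1 ∧ (π k).1 = (π (u, true)).1 := by
      rcases hnot with h | ⟨k, h1, h2⟩
      · exact Or.inl h.symm
      · exact Or.inr ⟨π k, h2, by rw [hI, h1]⟩
    have hB := hπ.exchangeable_of_not (x := (u, true)) (y := (w, false)) (y' := (w, true))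
      huw rfl (by simp) hadj hnot
    have hC := hπ.exchangeable_of_not (x := (w, false)) (y := (u, true)) (y' := (u, false))
      huw.symm rfl (by simp) hadj' hnot'
    obtain ⟨πB, hB1, hB2, hB3⟩ := hπ.exists_exchange huw hadj true true hB.1 hB.2
    obtain ⟨πC, hC1, hC2, hC3⟩ := hπ.exists_exchange huw hadj false false hC.1.symm
      fun h a b => hC.2 (π h) b (by rw [hI, a])
    have sB := sum_le_sum_map_list c
      [(u, true), (w, false), π (u, true), (w, true), π (w, true)]
      ({(u, true), (w, false), (u, true), π (u, true), (w, true), π (w, true)} :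
        Finset (V × Bool)) (by simp)
    have sC := sum_le_sum_map_list c
      [(u, true), (w, false), (u, false), π (u, false), π (w, false)]
      ({(u, true), (w, false), (u, false), π (u, false), (w, false), π (w, false)} :
        Finset (V × Bool)) (by simp)
    by_contra hcon
    push Not at hcon
    have kB := hcon πB _ hB1 hB2 (by simp) (by simp) hB3
    have kC := hcon πC _ hC1 hC2 (by simp) (by simp) hC3
    have kB := kB.trans_le sB
    have kC := kC.trans_le sC
    unfold exchangeLoss at kB kC
    rw [← NNReal.coe_lt_coe] at kB kC
    simp at kB kC
    have := (c (π (u, true))).2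
    have := (c (π (w, false))).2
    linarith

end
end Gluing

section Correspondence

open Equiv

variable {V : Type*} [DecidableEq V]

/-- The gluing `π` encodes the half-edge cover `H`: the tail half of `e` is selected if the outgoing
half-edge of its source leads to its target, and the head half is selected if the ingoing half-edge
of its target comes from its source. -/
structure Encodes (π : Perm (V × Bool)) (H : HalfEdgeCover V) : Prop extends IsGluing π where
  /-- The selected tail halves. -/
  mem_tails : ∀ e : Edge V, e ∈ H.1.1 ↔ (π (e.src, true)).1 = e.tgt
  /-- The selected head halves. -/
  mem_heads : ∀ e : Edge V, e ∈ H.1.2 ↔ (π (e.tgt, false)).1 = e.src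

lemma Edge.ne_rev {V : Type*} (e : Edge V) : e ≠ e.rev := fun h => e.2 (congrArg Edge.src h)

lemma card_inter_pair {X : Type*} [DecidableEq X] (s : Finset X) {a b : X} (hab : a ≠ b) :
    (s ∩ {a, b}).card = (if a ∈ s then 1 else 0) + (if b ∈ s then 1 else 0) := by
  rw [Finset.inter_comm, ← Finset.filter_mem_eq_inter, Finset.card_filter,
    Finset.sum_pair hab]

lemma exists_encodes (H : HalfEdgeCover V) : ∃ π, Encodes π H := by
  obtain ⟨⟨T, D⟩, hH⟩ := H
  simp only at hH
  choose o ho ho' using hH.outdegree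
  choose i hi hi' using hH.indegree
  simp only at ho ho' hi hi'
  have hT : ∀ e : Edge V, e ∈ T ↔ (o e.src).tgt = e.tgt := fun e =>
    ⟨fun he => by rw [← ho' e.src e ⟨he, rfl⟩], fun he => by
      have : e = o e.src := Subtype.ext (Prod.ext (ho e.src).2.symm he.symm)
      rw [this]; exact (ho e.src).1⟩
  have hD : ∀ e : Edge V, e ∈ D ↔ (i e.tgt).src = e.src := fun e =>
    ⟨fun he => by rw [← hi' e.tgt e ⟨he, rfl⟩], fun he => by
      have : e = i e.tgt := Subtype.ext (Prod.ext he.symm (hi e.tgt).2.symm)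
      rw [this]; exact (hi e.tgt).1⟩
  let N : V → Bool → V := fun v k => if k then (o v).tgt else (i v).src
  have hNne : ∀ v k, N v k ≠ v := by
    intro v k
    cases k
    · intro h
      exact (i v).2 (h.trans (hi v).2.symm)
    · intro h
      exact (o v).2 ((ho v).2.trans h.symm)
  have hNT : ∀ e : Edge V, e ∈ T ↔ N e.src true = e.tgt := hT
  have hND : ∀ e : Edge V, e ∈ D ↔ N e.tgt false = e.src := hD
  have hNN : ∀ v, N v true ≠ N v false := by
    intro v h
    let e : Edge V := ⟨(v, N v true), (hNne v true).symm⟩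
    exact hH.not_same_vertex e ⟨(hNT e).2 rfl, (hND e.rev).2 h.symm⟩
  have hsym : ∀ v k, ∃ j, N (N v k) j = v := by
    intro v k
    by_contra hcon
    push Not at hcon
    let e : Edge V := ⟨(v, N v k), (hNne v k).symm⟩
    have h1 : e.rev ∉ T := fun h => hcon true ((hNT e.rev).1 h)
    have h2 : e ∉ D := fun h => hcon false ((hND e).1 h)
    have h3 := hH.none_or_two e
    have h4 := hH.not_same_vertex e
    rw [card_inter_pair _ e.ne_rev, card_inter_pair _ e.ne_rev, if_neg h1, if_neg h2] at h3
    have h5 : e ∈ T ∨ e.rev ∈ D := by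
      cases k
      · exact Or.inr ((hND e.rev).2 rfl)
      · exact Or.inl ((hNT e).2 rfl)
    split_ifs at h3 <;> grind
  let f : V × Bool → V × Bool := fun h => (N h.1 h.2, decide (N (N h.1 h.2) true = h.1))
  have hf1 : ∀ h, N (f h).1 (f h).2 = h.1 := by
    rintro ⟨v, k⟩
    obtain ⟨j, hj⟩ := hsym v k
    simp only [f]
    by_cases h : N (N v k) true = v
    · simp [h]
    · cases j
      · simp [h, hj]
      · exact absurd hj h
  have hff : ∀ h, f (f h) = h := by
    rintro ⟨v, k⟩
    have h1 := hf1 (v, k)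
    have h2 : f (f (v, k)) = (N (f (v, k)).1 (f (v, k)).2,
      decide (N (N (f (v, k)).1 (f (v, k)).2) true = (f (v, k)).1)) := rfl
    rw [h2, h1]
    simp only [f]
    refine Prod.ext rfl ?_
    cases k
    · simpa using hNN v
    · simp
  have hf : Function.Involutive f := hff
  refine ⟨hf.toPerm, ⟨⟨hff, fun h => hNne _ _, ?_⟩, hNT, hND⟩⟩
  rintro ⟨v, k⟩ ⟨v', k'⟩ rfl h2
  change N v k = N v k' at h2
  cases k <;> cases k'
  · rfl
  · exact absurd h2.symm (hNN v)
  · exact absurd h2 (hNN v)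
  · rfl

lemma IsGluing.exists_halfEdgeCover [Fintype V] {π : Perm (V × Bool)} (hπ : IsGluing π) :
    ∃ H : HalfEdgeCover V, Encodes π H := by
  let T : Finset (Edge V) := Finset.univ.filter fun e => (π (e.src, true)).1 = e.tgt
  let D : Finset (Edge V) := Finset.univ.filter fun e => (π (e.tgt, false)).1 = e.src
  have hT : ∀ e : Edge V, e ∈ T ↔ (π (e.src, true)).1 = e.tgt := fun e => by simp [T]
  have hD : ∀ e : Edge V, e ∈ D ↔ (π (e.tgt, false)).1 = e.src := fun e => by simp [D]
  have hns : ∀ e : Edge V, ¬ (e ∈ T ∧ e.rev ∈ D) := by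
    rintro e ⟨h1, h2⟩
    have h1 := (hT e).1 h1
    have h2 := (hD e.rev).1 h2
    have := hπ.inj (e.src, true) (e.src, false) rfl (h1.trans h2.symm)
    simp at this
  -- An endpoint of `e` has a half-edge towards the other one if and only if the converse holds.
  have hpass : ∀ e : Edge V, (e ∈ T ∨ e.rev ∈ D) → (e.rev ∈ T ∨ e ∈ D) := by
    intro e he
    have : ∃ k, (π (e.src, k)).1 = e.tgt := by
      rcases he with he | he
      · exact ⟨true, (hT e).1 he⟩
      · exact ⟨false, (hD e.rev).1 he⟩
    obtain ⟨k, hk⟩ := this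
    have h2 : (π (e.tgt, (π (e.src, k)).2)).1 = e.src := by
      rw [← hk, Prod.mk.eta, hπ.invol]
    cases hj : (π (e.src, k)).2
    · rw [hj] at h2; exact Or.inr ((hD e).2 h2)
    · rw [hj] at h2; exact Or.inl ((hT e.rev).2 h2)
  refine ⟨⟨(T, D), ⟨fun u => ?_, fun u => ?_, fun e => ?_, hns⟩⟩, ⟨hπ, hT, hD⟩⟩
  · refine ⟨⟨(u, (π (u, true)).1), (hπ.ne (u, true)).symm⟩, ⟨(hT _).2 rfl, rfl⟩, ?_⟩
    rintro e ⟨he, rfl⟩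
    exact Subtype.ext (Prod.ext rfl ((hT e).1 he).symm)
  · refine ⟨⟨((π (u, false)).1, u), hπ.ne (u, false)⟩, ⟨(hD _).2 rfl, rfl⟩, ?_⟩
    rintro e ⟨he, rfl⟩
    exact Subtype.ext (Prod.ext ((hD e).1 he).symm rfl)
  · rw [card_inter_pair _ e.ne_rev, card_inter_pair _ e.ne_rev]
    have h1 := hns e
    have h2 := hns e.rev
    have h3 := hpass e
    have h4 := hpass e.rev
    have hr : e.rev.rev = e := rfl
    rw [hr] at h2 h4
    simp only
    split_ifs <;> simp_all

lemma halfEdgeShare_eq {π : Perm (V × Bool)} {H : HalfEdgeCover V} (h : Encodes π H) (e : Edge V) :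
    halfEdgeShare H e = (if (π (e.src, true)).1 = e.tgt then 1 / 2 else 0)
      + (if (π (e.tgt, false)).1 = e.src then 1 / 2 else 0) := by
  simp only [halfEdgeShare, h.mem_tails, h.mem_heads]

/-- The edge of which `h` is a half if its other endpoint is `n`. -/
def halfEdgeEdge (h : V × Bool) (n : V) (hn : n ≠ h.1) : Edge V :=
  if h.2 then ⟨(h.1, n), hn.symm⟩ else ⟨(n, h.1), hn⟩

variable [Fintype V]

lemma welfare_halfEdgeShare {π : Perm (V × Bool)} {H : HalfEdgeCover V} (h : Encodes π H)
    (b : Edge V → ℝ≥0) :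
    welfare halfEdgeShare b H = ∑ x, b (halfEdgeEdge x (π x).1 (h.ne x)) / 2 := by
  rw [Fintype.sum_prod_type]
  simp only [Fintype.sum_bool, Finset.sum_add_distrib]
  have h1 := sum_ite_src (fun u => (π (u, true)).1) (fun u => h.ne (u, true)) (fun e => b e / 2)
  have h2 := sum_ite_tgt (fun u => (π (u, false)).1) (fun u => h.ne (u, false)) (fun e => b e / 2)
  simp only [halfEdgeEdge, if_true, Bool.false_eq_true, if_false]
  rw [← h1, ← h2, ← Finset.sum_add_distrib]
  refine Finset.sum_congr rfl fun e _ => ?_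
  rw [halfEdgeShare_eq h, mul_add, mul_ite, mul_ite, mul_zero, mul_one_div]

lemma sum_exchangeLoss {π : Perm (V × Bool)} (c : V × Bool → ℝ≥0) (τ : Tour V) :
    ∑ e, tourShare τ e * exchangeLoss π c e.src e.tgt = 3 * ∑ h, c h := by
  have hsplit : ∀ d : V × Bool → ℝ≥0, ∑ h, d h = ∑ v, d (v, true) + ∑ v, d (v, false) := by
    intro d
    rw [Fintype.sum_prod_type]
    simp [Finset.sum_add_distrib]
  have hc := hsplit c
  have hπ := hsplit fun h => c (π h)
  rw [Equiv.sum_comp π c] at hπ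
  simp only [exchangeLoss, mul_add, Finset.sum_add_distrib (s := Finset.univ (α := Edge V))]
  have key := fun g : V → ℝ≥0 => sum_tourShare_src τ g
  have key' := fun g : V → ℝ≥0 => sum_tourShare_tgt τ g
  rw [key fun u => c (u, true), key fun u => c (π (u, true)),
    key fun u => (c (u, false) + c (π (u, false))) / 2, key' fun u => c (u, false),
    key' fun u => c (π (u, false)), key' fun u => (c (u, true) + c (π (u, true))) / 2,
    ← Finset.sum_div, ← Finset.sum_div, Finset.sum_add_distrib, Finset.sum_add_distrib]
  rw [← NNReal.coe_inj] at *
  push_cast at *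
  linarith

lemma smoothForHalfValue_halfEdgeShare (hV : 2 ≤ Fintype.card V)
    {f' : (Edge V → ℝ≥0) → HalfEdgeCover V} (hf' : IsExactMaximizer halfEdgeShare f') :
    SmoothForHalfValue halfEdgeShare (relaxedMechanism halfEdgeShare f')
      (opt (Ω := Tour V) tourShare) (1 / 2) 3 := by
  have := nonempty_tour hV
  refine smoothForHalfValue_of_exchange tourShare_le_one hf' fun τ H b => ?_
  obtain ⟨π, hπ⟩ := exists_encodes H
  let c : V × Bool → ℝ≥0 := fun x => b (halfEdgeEdge x (π x).1 (hπ.ne x)) / 2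
  have hc := welfare_halfEdgeShare hπ b
  refine ⟨fun e => exchangeLoss π c e.src e.tgt, fun e _ => ?_, ?_⟩
  · obtain ⟨π', S, hπ', hglue, hu, hw, hS, hle⟩ := hπ.exists_exchange_le e.2 c
    obtain ⟨Z, hZ⟩ := hπ'.exists_halfEdgeCover
    refine ⟨Z, ?_, ?_⟩
    · have hglue' : π' (e.tgt, false) = (e.src, true) := by
        rw [← hglue, hπ'.invol]
      rw [halfEdgeShare_eq hZ, if_pos (by rw [hglue]), if_pos (by rw [hglue'])]
      rw [add_halves]
    · rw [hc, welfare_halfEdgeShare hZ, ← Finset.sum_add_sum_compl S, add_comm]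
      refine add_le_add ?_ hle
      refine le_trans (Finset.sum_le_sum fun x hx => ?_)
        (Finset.sum_le_univ_sum_of_nonneg fun _ => zero_le)
      rw [Finset.mem_compl] at hx
      have h := hS x hx
      rw [Function.update_of_ne]
      · simp only [h, le_refl]
      · -- Outside of `S`, no half-edge of the new cover is a half of `e`.
        rintro he
        refine hx ?_
        obtain ⟨v, k⟩ := x
        cases k
        · have : v = e.tgt := congrArg Edge.tgt he
          rw [this]; exact hw
        · have : v = e.src := congrArg Edge.src he
          rw [this]; exact hu
  · rw [sum_exchangeLoss, hc]

lemma Tour.sq_ne (hV : 3 ≤ Fintype.card V) (τ : Tour V) (u : V) : τ.1 (τ.1 u) ≠ u := by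
  intro h
  have hc := τ.2.1
  have hpow : τ.1 ^ 2 = 1 := hc.pow_eq_one_iff.2 ⟨u, τ.apply_ne u, by simpa [sq] using h⟩
  have h1 := orderOf_dvd_of_pow_eq_one hpow
  rw [hc.orderOf, τ.2.2, Finset.card_univ] at h1
  have := Nat.le_of_dvd (by norm_num) h1
  omega

lemma isRelaxation_halfEdgeShare (hV : 3 ≤ Fintype.card V) :
    IsRelaxation (N := Edge V) (tourShare (V := V)) (halfEdgeShare (V := V)) := by
  have h : ∀ τ : Tour V, ∃ H : HalfEdgeCover V, halfEdgeShare H = tourShare τ := by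
    intro τ
    let T : Finset (Edge V) := Finset.univ.filter fun e => τ.1 e.src = e.tgt
    have hT : ∀ e : Edge V, e ∈ T ↔ τ.1 e.src = e.tgt := fun e => by simp [T]
    have hrev : ∀ e : Edge V, e ∈ T → e.rev ∉ T := by
      intro e h1 h2
      have h1 := (hT e).1 h1
      have h2 : τ.1 e.tgt = e.src := (hT e.rev).1 h2
      rw [← h1] at h2
      exact τ.sq_ne hV _ h2
    have hcover : IsHalfEdgeCover T T := by
      refine ⟨fun u => ?_, fun u => ?_, fun e => ?_, fun e he => hrev e he.1 he.2⟩
      · refine ⟨⟨(u, τ.1 u), (τ.apply_ne u).symm⟩, ⟨(hT _).2 rfl, rfl⟩, ?_⟩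
        rintro e ⟨he, rfl⟩
        exact Subtype.ext (Prod.ext rfl ((hT e).1 he).symm)
      · refine ⟨⟨(τ.1.symm u, u), fun h => τ.apply_ne u (τ.1.symm_apply_eq.1 h).symm⟩,
          ⟨(hT _).2 (τ.1.apply_symm_apply u), rfl⟩, ?_⟩
        rintro e ⟨he, rfl⟩
        exact Subtype.ext (Prod.ext (by simp [← (hT e).1 he]) rfl)
      · rw [card_inter_pair _ e.ne_rev]
        have := hrev e
        split_ifs <;> simp_all
    refine ⟨⟨(T, T), hcover⟩, funext fun e => ?_⟩
    simp only [halfEdgeShare, tourShare, hT]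
    split_ifs
    · exact add_halves 1
    · simp
  choose ι hι using h
  refine ⟨ι, fun τ τ' hττ => Subtype.ext (Equiv.ext fun u => ?_), hι⟩
  have h1 : tourShare τ = tourShare τ' := by rw [← hι, ← hι, hττ]
  have h2 := congrFun h1 ⟨(u, τ.1 u), (τ.apply_ne u).symm⟩
  simp only [tourShare, if_true] at h2
  by_contra hne
  rw [if_neg (fun h => hne h.symm)] at h2
  exact one_ne_zero h2

end Correspondence

/-! ### Three tours from a half-edge cover -/

section Orientation

open Equiv Equiv.Perm

variable {V : Type*}

/-- The undirected cycles of a gluing can be oriented: there is a permutation `ρ` such that the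
neighbours of `v` are `ρ v` and `ρ⁻¹ v`. Traversing a cycle is iterating `φ`: leave `v` by a
half-edge, and at the next vertex switch to the other half-edge. The reverse traversal, which starts
from the other half-edge of the same vertex, is a different cycle of `φ`, and one of the two is
chosen. -/
lemma IsGluing.exists_orientation [Finite V] {π : Perm (V × Bool)} (hπ : IsGluing π) :
    ∃ (ρ : Perm V) (s : V → Bool), ∀ v, (π (v, s v)).1 = ρ v ∧ (π (v, !s v)).1 = ρ.symm v := by
  have hI := hπ.invol
  let flip : Perm (V × Bool) := Equiv.prodCongr (Equiv.refl V) Equiv.boolNot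
  have hflip : ∀ v k, flip (v, k) = (v, !k) := fun v k => rfl
  have hff : ∀ h, flip (flip h) = h := by
    rintro ⟨v, k⟩; simp [hflip]
  have hfne : ∀ h, flip h ≠ h := by
    rintro ⟨v, k⟩; simp [hflip]
  set φ : Perm (V × Bool) := flip * π with hφ
  have hconj : flip * φ * flip⁻¹ = φ⁻¹ := by
    rw [eq_comm, inv_eq_iff_mul_eq_one]
    ext1 h
    have : flip⁻¹ = flip := by
      rw [inv_eq_iff_mul_eq_one]; ext1 h; exact hff h
    simp only [hφ, this, Perm.mul_apply, hff, hI, Perm.one_apply]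
  have hzpow : ∀ (j : ℤ) h, flip ((φ ^ j) h) = (φ ^ (-j)) (flip h) := by
    intro j h
    have : flip * φ ^ j = φ ^ (-j) * flip := by
      rw [zpow_neg, ← inv_zpow, ← hconj, conj_zpow]
      group
    exact congrArg (fun σ : Perm (V × Bool) => σ h) this
  have hsep : ∀ h, ¬ φ.SameCycle h (flip h) := by
    rintro h ⟨i, hi⟩
    rcases Int.even_or_odd' i with ⟨j, rfl | rfl⟩
    · refine hfne ((φ ^ j) h) ?_
      rw [hzpow, ← hi, ← Perm.mul_apply, ← zpow_add]
      congr 2; ring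
    · have h1 : flip ((φ ^ j) h) = φ ((φ ^ j) h) := by
        rw [hzpow, ← hi, ← Perm.mul_apply, ← zpow_add, ← Perm.mul_apply, ← zpow_one_add]
        congr 2; ring
      have h2 := flip.injective h1
      exact hπ.ne _ (congrArg Prod.fst h2.symm)
  let r : Setoid (V × Bool) := SameCycle.setoid φ
  let rep : V × Bool → V × Bool := fun h => Quotient.out (Quotient.mk r h)
  have hrep : ∀ h h', φ.SameCycle h h' → rep h = rep h' := fun h h' hh => by
    simp only [rep]; rw [Quotient.sound (s := r) hh]
  have hrep' : ∀ h, φ.SameCycle (rep h) h := fun h => Quotient.mk_out (s := r) h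
  obtain ⟨n, ⟨enc⟩⟩ := Finite.exists_equiv_fin (V × Bool)
  let S : V × Bool → Prop := fun h => enc (rep h) < enc (rep (flip h))
  have hne : ∀ h, rep h ≠ rep (flip h) := fun h hh =>
    hsep h ((hrep' h).symm.trans (hh ▸ hrep' (flip h)))
  have hSflip : ∀ h, S (flip h) ↔ ¬ S h := by
    intro h
    simp only [S, hff, not_lt]
    exact ⟨le_of_lt, fun h1 => lt_of_le_of_ne h1 fun h2 => hne h (enc.injective h2.symm)⟩
  have hSφ : ∀ h, S (φ h) ↔ S h := by
    intro h
    have h1 : rep (φ h) = rep h := hrep _ _ (sameCycle_apply_left.2 (SameCycle.refl _ _))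
    have h2 : rep (flip (φ h)) = rep (flip h) := by
      refine hrep _ _ ?_
      have : φ (flip (φ h)) = flip h := by simp [hφ, hff, hI]
      rw [← this]
      exact sameCycle_apply_right.2 (SameCycle.refl _ _)
    simp only [S, h1, h2]
  classical
  let s : V → Bool := fun v => decide (S (v, true))
  have hs : ∀ v k, S (v, k) ↔ k = s v := by
    intro v k
    have h : S (v, false) ↔ ¬ S (v, true) := hSflip (v, true)
    cases k
    · rw [h, eq_comm, decide_eq_false_iff_not]
    · rw [eq_comm, decide_eq_true_iff]
  have hstep : ∀ v, φ (v, s v) = ((π (v, s v)).1, s (π (v, s v)).1) := by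
    intro v
    refine Prod.ext rfl ?_
    have h1 : S (φ (v, s v)) := (hSφ _).2 ((hs _ _).2 rfl)
    exact (hs _ _).1 h1
  have hinj : Function.Injective fun v => (π (v, s v)).1 := by
    intro v v' h
    simp only at h
    have := hstep v
    rw [h, ← hstep v'] at this
    exact congrArg Prod.fst (φ.injective this)
  let ρ : Perm V := Equiv.ofBijective _ (Finite.injective_iff_bijective.1 hinj)
  have hρ : ∀ v, ρ v = (π (v, s v)).1 := fun v => rfl
  refine ⟨ρ, s, fun v => ⟨rfl, ?_⟩⟩
  rw [Equiv.eq_symm_apply]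
  obtain ⟨v₀, rfl⟩ := ρ.surjective v
  have h1 := hstep v₀
  rw [← hρ] at h1
  have h2 : π (v₀, s v₀) = (ρ v₀, !s (ρ v₀)) := by
    rw [← hflip, ← h1, hφ, Perm.mul_apply, hff]
  rw [← h2, hI]

end Orientation

section Coloring

open Equiv Equiv.Perm

variable {V : Type*}

/-- Let `ρ` be a permutation with two directions of travel along its cycles. A set of edges
`(u, ρ u)`, for `u` in `F`, and `(ρ u, u)`, for `u` in `B`, that consists of disjoint paths is
contained in a tour. -/
lemma exists_tour_of_paths [Fintype V] [DecidableEq V] (hV : 2 ≤ Fintype.card V) (ρ : Perm V)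
    {F B : V → Prop} (hFB : ∀ u, F u → ¬ B u ∧ ¬ B (ρ u) ∧ ¬ B (ρ.symm u))
    (hF : ∀ x, ∃ u, ρ.SameCycle x u ∧ ¬ F u) (hB : ∀ x, ∃ u, ρ.SameCycle x u ∧ ¬ B u) :
    ∃ τ : Tour V, ∀ u, (F u → τ.1 u = ρ u) ∧ (B u → τ.1 (ρ u) = u) := by
  classical
  let D : Set V := {u | F u ∨ B (ρ.symm u)}
  let f : V → V := fun u => if F u then ρ u else ρ.symm u
  have hfF : ∀ u, F u → f u = ρ u := fun u h => if_pos h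
  have hfB : ∀ u, ¬ F u → f u = ρ.symm u := fun u h => if_neg h
  have hinj : Function.Injective fun u : D => f u := by
    have aux : ∀ u v, F u → ¬ F v → B (ρ.symm v) → f u ≠ f v := by
      intro u v h1 h2 h3 h4
      rw [hfF u h1, hfB v h2] at h4
      exact (hFB u h1).2.1 (h4 ▸ h3)
    rintro ⟨u, hu⟩ ⟨v, hv⟩ huv
    simp only at huv
    by_cases h1 : F u <;> by_cases h2 : F v
    · rw [hfF u h1, hfF v h2] at huv
      exact Subtype.ext (ρ.injective huv)
    · exact absurd huv (aux u v h1 h2 (hv.resolve_left h2))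
    · exact absurd huv.symm (aux v u h2 h1 (hu.resolve_left h1))
    · rw [hfB u h1, hfB v h2] at huv
      exact Subtype.ext (ρ.symm.injective huv)
  obtain ⟨σ, hσ⟩ := Equiv.Perm.exists_extending_pair (fun u : D => (u : V)) (fun u : D => f u)
    Subtype.val_injective hinj
  have hσ : ∀ u ∈ D, σ u = f u := fun u hu => hσ ⟨u, hu⟩
  obtain ⟨τ, hτ⟩ := exists_tour_eq_off hV σ Dᶜ fun x => by
    -- A cycle of `σ` inside `D` would follow a whole cycle of `ρ` in one of the two directions.
    by_contra hcon
    push Not at hcon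
    have hall : ∀ y, σ.SameCycle x y → y ∈ D := fun y hy => by
      by_contra h; exact hcon y h hy
    by_cases hx : F x
    · have key : ∀ n : ℕ, F ((ρ ^ n) x) ∧ σ.SameCycle x ((ρ ^ n) x) := by
        intro n
        induction n with
        | zero => exact ⟨hx, SameCycle.refl _ _⟩
        | succ n ih =>
          obtain ⟨h1, h2⟩ := ih
          rw [pow_succ', Perm.mul_apply]
          set y := (ρ ^ n) x
          have h3 : σ.SameCycle x (ρ y) := by
            rw [← hfF y h1, ← hσ y (hall y h2)]
            exact sameCycle_apply_right.2 h2
          refine ⟨(hall _ h3).resolve_right fun h => (hFB y h1).1 ?_, h3⟩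
          simpa using h
      obtain ⟨u, hu, hFu⟩ := hF x
      obtain ⟨n, rfl⟩ := hu.exists_nat_pow_eq
      exact hFu (key n).1
    · have hx' : B (ρ.symm x) := (hall x (SameCycle.refl _ _)).resolve_left hx
      have key : ∀ n : ℕ, (¬ F ((ρ⁻¹ ^ n) x) ∧ B (ρ.symm ((ρ⁻¹ ^ n) x))) ∧
          σ.SameCycle x ((ρ⁻¹ ^ n) x) := by
        intro n
        induction n with
        | zero => exact ⟨⟨hx, hx'⟩, SameCycle.refl _ _⟩
        | succ n ih =>
          obtain ⟨⟨h0, h1⟩, h2⟩ := ih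
          rw [pow_succ', Perm.mul_apply]
          set y := (ρ⁻¹ ^ n) x
          change (¬ F (ρ.symm y) ∧ B (ρ.symm (ρ.symm y))) ∧ σ.SameCycle x (ρ.symm y)
          have h3 : σ.SameCycle x (ρ.symm y) := by
            rw [← hfB y h0, ← hσ y (hall y h2)]
            exact sameCycle_apply_right.2 h2
          have h4 : ¬ F (ρ.symm y) := fun h => (hFB _ h).1 h1
          exact ⟨⟨h4, (hall _ h3).resolve_left h4⟩, h3⟩
      obtain ⟨u, hu, hBu⟩ := hB (ρ.symm x)
      have hu : (ρ⁻¹).SameCycle x u :=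
        sameCycle_inv.2 (sameCycle_symm_apply_left.1 hu)
      have hu : (ρ⁻¹).SameCycle x (ρ u) := by
        rw [sameCycle_inv] at hu ⊢
        exact sameCycle_apply_right.2 hu
      obtain ⟨n, hn⟩ := hu.exists_nat_pow_eq
      have := (key n).1.2
      rw [hn] at this
      exact hBu (by simpa using this)
  have hτ : ∀ u ∈ D, τ.1 u = f u := fun u hu => by
    rw [hτ u (by simpa using hu), hσ u hu]
  refine ⟨τ, fun u => ⟨fun h => ?_, fun h => ?_⟩⟩
  · rw [hτ u (Or.inl h), hfF u h]
  · have h1 : ¬ F (ρ u) := fun h' => (hFB _ h').2.2 (by simpa using h)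
    rw [hτ (ρ u) (Or.inr (by simpa using h)), hfB _ h1]
    simp

/-- The data for three tours on the cycle of `x` under `ρ`. The predicate `s` tells for every vertex
`u` whether its two half-edges agree with the direction of `ρ`, so that the edge `(u, ρ u)` is
selected with one half for each of the endpoints `u` and `ρ u` that satisfies `s`, and its reverse
with the other halves. The tour `k` is to use the edges `(u, ρ u)` with `F k u` and the edges
`(ρ u, u)` with `B k u`, and every edge is needed as many times as it has selected halves. -/
structure IsThreeColoring (ρ : Perm V) (s : V → Prop) (x : V) (F B : Fin 3 → V → Prop) : Prop where
  /-- The edges of one color make up disjoint paths and full cycles. -/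
  conflict : ∀ k u, ρ.SameCycle x u → F k u → ¬ B k u ∧ ¬ B k (ρ u) ∧ ¬ B k (ρ.symm u)
  /-- No color contains the full cycle in forward direction. -/
  missF : ∀ k, ∃ u, ρ.SameCycle x u ∧ ¬ F k u
  /-- No color contains the full cycle in backward direction. -/
  missB : ∀ k, ∃ u, ρ.SameCycle x u ∧ ¬ B k u
  /-- A selected forward edge has a color. -/
  oneF : ∀ u, ρ.SameCycle x u → (s u ∨ s (ρ u)) → ∃ k, F k u
  /-- A forward edge with two selected halves has two colors. -/
  twoF : ∀ u, ρ.SameCycle x u → s u → s (ρ u) → ∃ k l, k ≠ l ∧ F k u ∧ F l u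
  /-- A selected backward edge has a color. -/
  oneB : ∀ u, ρ.SameCycle x u → (¬ s u ∨ ¬ s (ρ u)) → ∃ k, B k u
  /-- A backward edge with two selected halves has two colors. -/
  twoB : ∀ u, ρ.SameCycle x u → ¬ s u → ¬ s (ρ u) → ∃ k l, k ≠ l ∧ B k u ∧ B l u

/-- Travelling in the opposite direction. -/
lemma IsThreeColoring.swap {ρ : Perm V} {s : V → Prop} {x : V} {F B : Fin 3 → V → Prop}
    (h : IsThreeColoring ρ s x F B) : IsThreeColoring ρ (fun u => ¬ s u) x B F where
  conflict k u hu hB := by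
    refine ⟨fun hF => (h.conflict k u hu hF).1 hB, fun hF => ?_, fun hF => ?_⟩
    · exact (h.conflict k _ (sameCycle_apply_right.2 hu) hF).2.2 (by simpa using hB)
    · exact (h.conflict k _ (sameCycle_symm_apply_right.2 hu) hF).2.1 (by simpa using hB)
  missF := h.missB
  missB := h.missF
  oneF := h.oneB
  twoF := h.twoB
  oneB u hu hs := h.oneF u hu (by simpa using hs)
  twoB u hu h1 h2 := h.twoF u hu (by simpa using h1) (by simpa using h2)

/-- If no edge has two halves in backward direction, but some edge has two in forward direction,
then color `0` can take all forward edges but one, and color `1` all backward edges. If there are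
backward edges, the exception is an edge with one selected half in each direction, and color `2`
takes it together with the second copies of the doubled forward edges. Otherwise, a second exception
makes room in color `2`, and color `1` takes both exceptions. -/
lemma exists_isThreeColoring_of_forward [Finite V] {ρ : Perm V} (hρ : ∀ u, ρ u ≠ u)
    (hρ2 : ∀ u, ρ (ρ u) ≠ u) {s : V → Prop} {x : V}
    (hF : ∃ u, ρ.SameCycle x u ∧ s u ∧ s (ρ u))
    (hB : ∀ u, ρ.SameCycle x u → ¬ s u → s (ρ u)) :
    ∃ F B, IsThreeColoring ρ s x F B := by
  obtain ⟨p, hp, hsp, hsp'⟩ := hF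
  have hx : ρ.SameCycle x x := SameCycle.refl _ _
  have hstep : ∀ u, ρ.SameCycle x u → ρ.SameCycle x (ρ u) := fun u => sameCycle_apply_right.2
  by_cases hall : ∀ u, ρ.SameCycle x u → s u → s (ρ u)
  · have hs : ∀ u, ρ.SameCycle x u → s u := by
      intro u hu
      obtain ⟨n, rfl⟩ := (hp.symm.trans hu).exists_nat_pow_eq
      induction n with
      | zero => exact hsp
      | succ n ih =>
        have hn : ρ.SameCycle x ((ρ ^ n) p) := hp.trans ⟨n, by simp⟩
        rw [pow_succ', Perm.mul_apply]
        exact hall _ hn (ih hn)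
    refine ⟨![fun u => u ≠ x, fun u => u = x ∨ u = ρ x, fun u => u ≠ ρ x],
      fun _ _ => False, ?_, ?_, ?_, ?_, ?_, ?_, ?_⟩
    · intro k u _ _; simp
    · intro k
      fin_cases k
      · exact ⟨x, hx, by simp⟩
      · exact ⟨ρ (ρ x), hstep _ (hstep _ hx), by simp [hρ2, hρ]⟩
      · exact ⟨ρ x, hstep _ hx, by simp⟩
    · exact fun k => ⟨x, hx, by simp⟩
    · intro u _ _
      by_cases h : u = x
      · exact ⟨1, Or.inl h⟩
      · exact ⟨0, h⟩
    · intro u _ _ _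
      by_cases h : u = x
      · exact ⟨1, 2, by decide, Or.inl h, fun h' => hρ x (by rw [← h', h])⟩
      by_cases h' : u = ρ x
      · exact ⟨0, 1, by decide, h, Or.inr h'⟩
      · exact ⟨0, 2, by decide, h, h'⟩
    · intro u hu h
      exact (h.elim (fun h => h (hs _ hu)) fun h => h (hs _ (hstep _ hu))).elim
    · intro u hu h
      exact absurd (hs u hu) h
  · push Not at hall
    obtain ⟨e, he, hse, hse'⟩ := hall
    refine ⟨![fun u => u ≠ e, fun _ => False, fun u => s u ∧ s (ρ u) ∨ u = e],
      ![fun _ => False, fun u => ¬ (s u ∧ s (ρ u)), fun _ => False], ?_, ?_, ?_, ?_, ?_, ?_, ?_⟩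
    · intro k u _ h
      fin_cases k
      · simp
      · exact absurd h (by simp)
      · simp
    · intro k
      fin_cases k
      · exact ⟨e, he, by simp⟩
      · exact ⟨e, he, by simp⟩
      · exact ⟨ρ e, hstep _ he, by simp [hse', hρ]⟩
    · intro k
      fin_cases k
      · exact ⟨p, hp, by simp⟩
      · exact ⟨p, hp, by simp [hsp, hsp']⟩
      · exact ⟨p, hp, by simp⟩
    · intro u _ _
      by_cases h : u = e
      · exact ⟨2, Or.inr h⟩
      · exact ⟨0, h⟩
    · intro u _ h1 h2
      refine ⟨0, 2, by decide, ?_, Or.inl ⟨h1, h2⟩⟩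
      rintro rfl
      exact hse' h2
    · intro u _ h
      exact ⟨1, by change ¬ (s u ∧ s (ρ u)); tauto⟩
    · intro u hu h1 h2
      exact absurd (hB u hu h1) h2

/-- Color `0` takes the forward edges, color `1` takes the backward edges, and color `2` takes the
second copies of the doubled edges. Colors `0` and `1` contain no full cycle unless there
is no doubled edge in the opposite direction; then they pass on some edges to other colors. -/
lemma exists_isThreeColoring [Finite V] {ρ : Perm V} (hρ : ∀ u, ρ u ≠ u)
    (hρ2 : ∀ u, ρ (ρ u) ≠ u) (s : V → Prop) (x : V) :
    ∃ F B, IsThreeColoring ρ s x F B := by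
  have hx : ρ.SameCycle x x := SameCycle.refl _ _
  have hstep : ∀ u, ρ.SameCycle x u → ρ.SameCycle x (ρ u) := fun u => sameCycle_apply_right.2
  by_cases hF : ∃ u, ρ.SameCycle x u ∧ s u ∧ s (ρ u) <;>
    by_cases hB : ∃ u, ρ.SameCycle x u ∧ ¬ s u ∧ ¬ s (ρ u)
  · obtain ⟨p, hp, hsp, hsp'⟩ := hF
    obtain ⟨m, hm, hsm, hsm'⟩ := hB
    refine ⟨![fun u => s u ∨ s (ρ u), fun _ => False, fun u => s u ∧ s (ρ u)],
      ![fun _ => False, fun u => ¬ s u ∨ ¬ s (ρ u), fun u => ¬ s u ∧ ¬ s (ρ u)],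
      ?_, ?_, ?_, ?_, ?_, ?_, ?_⟩
    · intro k u _ h
      fin_cases k
      · simp
      · exact absurd h (by simp)
      · have h : s u ∧ s (ρ u) := h
        change ¬ (¬ s u ∧ ¬ s (ρ u)) ∧ ¬ (¬ s (ρ u) ∧ ¬ s (ρ (ρ u))) ∧
          ¬ (¬ s (ρ.symm u) ∧ ¬ s (ρ (ρ.symm u)))
        rw [Equiv.apply_symm_apply]
        tauto
    · intro k
      fin_cases k
      · exact ⟨m, hm, by simp [hsm, hsm']⟩
      · exact ⟨m, hm, by simp⟩
      · exact ⟨m, hm, by simp [hsm]⟩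
    · intro k
      fin_cases k
      · exact ⟨p, hp, by simp⟩
      · exact ⟨p, hp, by simp [hsp, hsp']⟩
      · exact ⟨p, hp, by simp [hsp]⟩
    · exact fun u _ h => ⟨0, h⟩
    · exact fun u _ h1 h2 => ⟨0, 2, by decide, Or.inl h1, h1, h2⟩
    · exact fun u _ h => ⟨1, h⟩
    · exact fun u _ h1 h2 => ⟨1, 2, by decide, Or.inl h1, h1, h2⟩
  · push Not at hB
    exact exists_isThreeColoring_of_forward hρ hρ2 hF hB
  · push Not at hF
    obtain ⟨F, B, h⟩ := exists_isThreeColoring_of_forward hρ hρ2 (s := fun u => ¬ s u) hB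
      fun u hu h => hF u hu (not_not.1 h)
    refine ⟨B, F, ?_⟩
    simpa using h.swap
  · push Not at hF hB
    -- The directions alternate along the cycle, so that its length is even and at least four.
    -- Color `2` relieves colors `0` and `1` of one edge each, and these two are disjoint.
    have h1 : s (ρ (ρ (ρ x))) ↔ ¬ s x := by
      have a0 := hF x hx
      have a1 := hF _ (hstep _ hx)
      have a2 := hF _ (hstep _ (hstep _ hx))
      have b0 := hB x hx
      have b1 := hB _ (hstep _ hx)
      have b2 := hB _ (hstep _ (hstep _ hx))
      tauto
    have h3 : ρ (ρ (ρ x)) ≠ x := by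
      intro h; rw [h] at h1; tauto
    refine ⟨![fun u => u ≠ x, fun _ => False, fun u => u = x],
      ![fun _ => False, fun u => u ≠ ρ (ρ x), fun u => u = ρ (ρ x)], ?_, ?_, ?_, ?_, ?_, ?_, ?_⟩
    · intro k u _ h
      fin_cases k
      · simp
      · exact absurd h (by simp)
      · have h : u = x := h
        subst h
        refine ⟨fun h => hρ2 u h.symm, fun h => hρ (ρ u) h.symm, fun h => h3 ?_⟩
        have h : ρ.symm u = ρ (ρ u) := h
        rw [← h, Equiv.apply_symm_apply]
    · intro k
      fin_cases k
      · exact ⟨x, hx, by simp⟩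
      · exact ⟨x, hx, by simp⟩
      · exact ⟨ρ x, hstep _ hx, by simp [hρ]⟩
    · intro k
      fin_cases k
      · exact ⟨x, hx, by simp⟩
      · exact ⟨ρ (ρ x), hstep _ (hstep _ hx), by simp⟩
      · exact ⟨x, hx, fun h => hρ2 x h.symm⟩
    · intro u _ _
      by_cases h : u = x
      · exact ⟨2, h⟩
      · exact ⟨0, h⟩
    · exact fun u hu h1 h2 => absurd h2 (hF u hu h1)
    · intro u _ _
      by_cases h : u = ρ (ρ x)
      · exact ⟨2, h⟩
      · exact ⟨1, h⟩
    · exact fun u hu h1 h2 => absurd (hB u hu h1) h2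

end Coloring

section ThreeTours

open Equiv Equiv.Perm

variable {V : Type*} [Fintype V] [DecidableEq V]

/-- Colorings of single cycles are put together, and each color is completed to a tour. -/
lemma exists_three_tours_of_orientation (hV : 2 ≤ Fintype.card V) {ρ : Perm V}
    (hρ : ∀ u, ρ u ≠ u) (hρ2 : ∀ u, ρ (ρ u) ≠ u) (s : V → Prop) :
    ∃ T : Fin 3 → Tour V,
      (∀ u, (s u ∨ s (ρ u)) → ∃ k, (T k).1 u = ρ u) ∧
      (∀ u, s u → s (ρ u) → ∃ k l, k ≠ l ∧ (T k).1 u = ρ u ∧ (T l).1 u = ρ u) ∧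
      (∀ u, (¬ s u ∨ ¬ s (ρ u)) → ∃ k, (T k).1 (ρ u) = u) ∧
      (∀ u, ¬ s u → ¬ s (ρ u) → ∃ k l, k ≠ l ∧ (T k).1 (ρ u) = u ∧ (T l).1 (ρ u) = u) := by
  choose F B h using exists_isThreeColoring hρ hρ2 s
  let r : Setoid V := SameCycle.setoid ρ
  let rep : V → V := fun u => Quotient.out (Quotient.mk r u)
  have hrep : ∀ u v, ρ.SameCycle u v → rep u = rep v := fun u v huv => by
    simp only [rep]; rw [Quotient.sound (s := r) huv]
  have hrep' : ∀ u, ρ.SameCycle (rep u) u := fun u => Quotient.mk_out (s := r) u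
  have hrepρ : ∀ u, rep (ρ u) = rep u := fun u =>
    hrep _ _ (sameCycle_apply_left.2 (SameCycle.refl _ _))
  have hrepρ' : ∀ u, rep (ρ.symm u) = rep u := fun u =>
    hrep _ _ (sameCycle_symm_apply_left.2 (SameCycle.refl _ _))
  have hT : ∀ k, ∃ τ : Tour V, ∀ u, (F (rep u) k u → τ.1 u = ρ u) ∧
      (B (rep u) k u → τ.1 (ρ u) = u) := by
    intro k
    refine exists_tour_of_paths hV ρ (F := fun u => F (rep u) k u) (B := fun u => B (rep u) k u)
      (fun u hu => ?_) (fun x => ?_) (fun x => ?_)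
    · rw [hrepρ, hrepρ']
      exact (h (rep u)).conflict k u (hrep' u) hu
    · obtain ⟨u, hu, hFu⟩ := (h (rep x)).missF k
      have hxu := (hrep' x).symm.trans hu
      exact ⟨u, hxu, by rwa [← hrep x u hxu]⟩
    · obtain ⟨u, hu, hBu⟩ := (h (rep x)).missB k
      have hxu := (hrep' x).symm.trans hu
      exact ⟨u, hxu, by rwa [← hrep x u hxu]⟩
  choose T hT using hT
  refine ⟨T, fun u hs => ?_, fun u h1 h2 => ?_, fun u hs => ?_, fun u h1 h2 => ?_⟩
  · obtain ⟨k, hk⟩ := (h (rep u)).oneF u (hrep' u) hs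
    exact ⟨k, (hT k u).1 hk⟩
  · obtain ⟨k, l, hkl, hk, hl⟩ := (h (rep u)).twoF u (hrep' u) h1 h2
    exact ⟨k, l, hkl, (hT k u).1 hk, (hT l u).1 hl⟩
  · obtain ⟨k, hk⟩ := (h (rep u)).oneB u (hrep' u) hs
    exact ⟨k, (hT k u).2 hk⟩
  · obtain ⟨k, l, hkl, hk, hl⟩ := (h (rep u)).twoB u (hrep' u) h1 h2
    exact ⟨k, l, hkl, (hT k u).2 hk, (hT l u).2 hl⟩

/-- Every edge lies on at least as many of the three tours as it has selected halves. -/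
lemma exists_three_tours (hV : 2 ≤ Fintype.card V) (H : HalfEdgeCover V) :
    ∃ T : Fin 3 → Tour V, ∀ e, 2 * halfEdgeShare H e ≤ ∑ k, tourShare (T k) e := by
  obtain ⟨π, hπ⟩ := exists_encodes H
  obtain ⟨ρ, s, hρs⟩ := hπ.exists_orientation
  have hρ : ∀ u, ρ u ≠ u := fun u => by rw [← (hρs u).1]; exact hπ.ne _
  have hρ2 : ∀ u, ρ (ρ u) ≠ u := by
    intro u h
    have h1 : ρ u = ρ.symm u := by rw [Equiv.eq_symm_apply, h]
    rw [← (hρs u).1, ← (hρs u).2] at h1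
    have := hπ.inj (u, s u) (u, !s u) rfl h1
    simp at this
  obtain ⟨T, oneF, twoF, oneB, twoB⟩ :=
    exists_three_tours_of_orientation hV hρ hρ2 fun u => s u = true
  refine ⟨T, fun e => ?_⟩
  have hone : ∀ k, (T k).1 e.src = e.tgt → (1 : ℝ≥0) ≤ ∑ k, tourShare (T k) e := by
    intro k hk
    calc (1 : ℝ≥0) = tourShare (T k) e := by simp [tourShare, hk]
      _ ≤ _ := Finset.single_le_sum (f := fun k => tourShare (T k) e) (fun _ _ => zero_le)
        (Finset.mem_univ k)
  have htwo : ∀ k l, k ≠ l → (T k).1 e.src = e.tgt → (T l).1 e.src = e.tgt →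
      (2 : ℝ≥0) ≤ ∑ k, tourShare (T k) e := by
    intro k l hkl hk hl
    calc (2 : ℝ≥0) = tourShare (T k) e + tourShare (T l) e := by
          simp [tourShare, hk, hl, one_add_one_eq_two]
      _ = ∑ j ∈ {k, l}, tourShare (T j) e := 
          (Finset.sum_pair (f := fun j => tourShare (T j) e) hkl).symm
      _ ≤ _ := Finset.sum_le_univ_sum_of_nonneg fun _ => zero_le
  -- The two halves of `e` in terms of the direction of travel.
  have htail : (π (e.src, true)).1 = e.tgt →
      (s e.src = true ∧ e.tgt = ρ e.src) ∨ (¬ s e.src = true ∧ e.src = ρ e.tgt) := by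
    intro h
    have h1 := hρs e.src
    by_cases hs : s e.src = true
    · rw [hs] at h1
      exact Or.inl ⟨hs, h.symm.trans h1.1⟩
    · rw [Bool.not_eq_true] at hs
      rw [hs] at h1
      refine Or.inr ⟨by simp [hs], ?_⟩
      rw [← Equiv.symm_apply_eq, ← h1.2, ← h]
      rfl
  have hhead : (π (e.tgt, false)).1 = e.src →
      (s e.tgt = true ∧ e.tgt = ρ e.src) ∨ (¬ s e.tgt = true ∧ e.src = ρ e.tgt) := by
    intro h
    have h1 := hρs e.tgt
    by_cases hs : s e.tgt = true
    · rw [hs] at h1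
      refine Or.inl ⟨hs, ?_⟩
      rw [← Equiv.symm_apply_eq, ← h1.2, ← h]
      rfl
    · rw [Bool.not_eq_true] at hs
      rw [hs] at h1
      exact Or.inr ⟨by simp [hs], h.symm.trans h1.1⟩
  have hnot : ¬ (e.tgt = ρ e.src ∧ e.src = ρ e.tgt) := by
    rintro ⟨h1, h2⟩
    rw [h1] at h2
    exact hρ2 _ h2.symm
  rw [halfEdgeShare_eq hπ]
  by_cases hA : (π (e.src, true)).1 = e.tgt <;> by_cases hB : (π (e.tgt, false)).1 = e.src
  · rw [if_pos hA, if_pos hB, add_halves, mul_one]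
    rcases htail hA with ⟨a1, a2⟩ | ⟨a1, a2⟩ <;> rcases hhead hB with ⟨b1, b2⟩ | ⟨b1, b2⟩
    · obtain ⟨k, l, hkl, hk, hl⟩ := twoF e.src a1 (by rw [← a2]; exact b1)
      exact htwo k l hkl (hk.trans a2.symm) (hl.trans a2.symm)
    · exact absurd ⟨a2, b2⟩ hnot
    · exact absurd ⟨b2, a2⟩ hnot
    · obtain ⟨k, l, hkl, hk, hl⟩ := twoB e.tgt b1 (by rw [← a2]; exact a1)
      rw [← a2] at hk hl
      exact htwo k l hkl hk hl
  · rw [if_pos hA, if_neg hB, add_zero, mul_one_div_cancel two_ne_zero]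
    rcases htail hA with ⟨a1, a2⟩ | ⟨a1, a2⟩
    · obtain ⟨k, hk⟩ := oneF e.src (Or.inl a1)
      exact hone k (hk.trans a2.symm)
    · obtain ⟨k, hk⟩ := oneB e.tgt (Or.inr (by rw [← a2]; exact a1))
      rw [← a2] at hk
      exact hone k hk
  · rw [if_neg hA, if_pos hB, zero_add, mul_one_div_cancel two_ne_zero]
    rcases hhead hB with ⟨a1, a2⟩ | ⟨a1, a2⟩
    · obtain ⟨k, hk⟩ := oneF e.src (Or.inr (by rw [← a2]; exact a1))
      exact hone k (hk.trans a2.symm)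
    · obtain ⟨k, hk⟩ := oneB e.tgt (Or.inl a1)
      rw [← a2] at hk
      exact hone k hk
  · simp [if_neg hA, if_neg hB]

lemma isObliviousRounding_threeTourRounding {T : HalfEdgeCover V → Fin 3 → Tour V}
    (hT : ∀ H e, 2 * halfEdgeShare H e ≤ ∑ k, tourShare (T H k) e) :
    IsObliviousRounding tourShare halfEdgeShare (3 / 2) (threeTourRounding T) := by
  rw [isObliviousRounding_iff]
  intro H e
  unfold roundedShare threeTourRounding
  rw [sum_toNNReal_map_uniform]
  have h := hT H e
  rw [← NNReal.coe_le_coe] at h ⊢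
  push_cast at h ⊢
  rw [Fintype.card_fin]
  norm_num
  linarith

end ThreeTours

section TwoVertices

variable {V : Type*} [Fintype V] [DecidableEq V]

lemma tourShare_eq_one_of_card_eq_two (hV : Fintype.card V = 2) (τ : Tour V) (e : Edge V) :
    tourShare τ e = 1 := by
  refine if_pos ?_
  by_contra h
  have h1 : ({e.src, e.tgt, τ.1 e.src} : Finset V).card = 3 := by
    rw [Finset.card_eq_three]
    exact ⟨_, _, _, e.2, (τ.apply_ne _).symm, fun h' => h h'.symm, rfl⟩
  have h2 := Finset.card_le_univ ({e.src, e.tgt, τ.1 e.src} : Finset V)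
  omega

/-- On two vertices, there is only one tour, and the relaxation to the tours themselves will do. -/
lemma exists_achievesPoA_of_card_eq_two (hV : Fintype.card V = 2) :
    ∃ M : Mechanism (Edge V) (Tour V),
      IsObliviousRoundingMechanism tourShare (3 / 2) M ∧ AchievesPoA tourShare M 9 := by
  have := nonempty_tour hV.ge
  obtain ⟨f', hf'⟩ := exists_isExactMaximizer (tourShare (V := V))
  have hR : IsObliviousRounding (tourShare (V := V)) tourShare (3 / 2) PMF.pure := by
    rw [isObliviousRounding_iff]
    intro τ e
    rw [roundedShare, sum_toNNReal_pure]
    refine mul_le_of_le_one_left' ?_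
    rw [← NNReal.coe_le_coe]
    push_cast
    norm_num
  refine ⟨roundedMechanism tourShare f' PMF.pure, ⟨Tour V, inferInstance, tourShare, f', PMF.pure,
    ⟨id, Function.injective_id, fun _ => rfl⟩, hf', hR, rfl⟩, ?_⟩
  have h9 : ((3 : ℝ≥0∞) * (2 * (3 / 2 : ℝ≥0) : ℝ≥0)) = 9 := by
    rw [mul_div_cancel₀ _ two_ne_zero]
    norm_num
  rw [← h9]
  refine achievesPoA_roundedMechanism tourShare_le_one hf' (by norm_num) hR (OPT := opt tourShare)
    (fun _ => le_rfl) ?_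
  refine smoothForHalfValue_of_exchange tourShare_le_one hf' fun τ₀ τ b => ⟨b, fun e _ => ?_, ?_⟩
  · refine ⟨τ, (tourShare_eq_one_of_card_eq_two hV τ e).ge, ?_⟩
    simp only [welfare, tourShare_eq_one_of_card_eq_two hV, mul_one]
    rw [← Finset.add_sum_erase _ _ (Finset.mem_univ e), add_comm]
    gcongr
    refine le_trans (Finset.sum_le_sum fun i hi => ?_)
      (Finset.sum_le_univ_sum_of_nonneg (s := Finset.univ.erase e) fun _ => zero_le)
    rw [Function.update_of_ne (Finset.ne_of_mem_erase hi)]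
  · simp only [welfare, tourShare_eq_one_of_card_eq_two hV, mul_one, one_mul]
    exact le_mul_of_one_le_left' (by norm_num)

end TwoVertices

end MaxTSP

open MaxTSP
theorem mainTheorem7 {V : Type*} [Fintype V] [DecidableEq V] (hV : 2 ≤ Fintype.card V) :
    -- the Price of Anarchy of 9
    (∃ M : Mechanism (Edge V) (Tour V),
      IsObliviousRoundingMechanism tourShare (3 / 2) M ∧
      AchievesPoA tourShare M 9) ∧
    -- Fisher's algorithm: the cycle cover relaxation
    (IsRelaxation (N := Edge V) tourShare coverShare ∧
      (∃ f' : (Edge V → NNReal) → CycleCover V,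
        IsExactMaximizer coverShare f') ∧
      (∃ g : (σ : CycleCover V) → Removal σ → Tour V,
        IsPatching g) ∧
      (∀ f' : (Edge V → NNReal) → CycleCover V,
        IsExactMaximizer coverShare f' →
        SmoothForHalfValue coverShare
          (relaxedMechanism coverShare f')
          (opt coverShare) (1 / 2) 3) ∧
      (∀ g : (σ : CycleCover V) → Removal σ → Tour V,
        IsPatching g →
        IsObliviousRounding tourShare coverShare 2
          (fisherRounding g) ∧
        ∀ f' : (Edge V → NNReal) → CycleCover V,
          IsExactMaximizer coverShare f' →
          AchievesPoA tourShare
            (roundedMechanism tourShare f' (fisherRounding g)) 12)) ∧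
    -- the relaxation to cycle covers without 2-cycles but with half-edges
    (3 ≤ Fintype.card V →
      IsRelaxation (N := Edge V) tourShare halfEdgeShare ∧
      (∃ f' : (Edge V → NNReal) → HalfEdgeCover V,
        IsExactMaximizer halfEdgeShare f') ∧
      (∀ f' : (Edge V → NNReal) → HalfEdgeCover V,
        IsExactMaximizer halfEdgeShare f' →
        SmoothForHalfValue halfEdgeShare
          (relaxedMechanism halfEdgeShare f')
          (opt (Ω := Tour V) tourShare) (1 / 2) 3) ∧
      (∃ T : HalfEdgeCover V → Fin 3 → Tour V,
        IsObliviousRounding tourShare halfEdgeShare (3 / 2)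
          (threeTourRounding T) ∧
        ∀ f' : (Edge V → NNReal) → HalfEdgeCover V,
          IsExactMaximizer halfEdgeShare f' →
          AchievesPoA tourShare
            (roundedMechanism tourShare f' (threeTourRounding T)) 9)) := by
  have hT := nonempty_tour hV
  have hC : Nonempty (CycleCover V) := hT.map fun τ => ⟨τ.1, τ.apply_ne⟩
  choose T hTH using exists_three_tours hV
  have hR := isObliviousRounding_threeTourRounding hTH
  have h9 : ((3 : ℝ≥0∞) * (2 * (3 / 2 : ℝ≥0) : ℝ≥0)) = 9 := by
    rw [mul_div_cancel₀ _ two_ne_zero]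
    norm_num
  have h12 : ((3 : ℝ≥0∞) * (2 * (2 : ℝ≥0) : ℝ≥0)) = 12 := by
    push_cast
    norm_num
  have hPoA : ∀ f' : (Edge V → NNReal) → HalfEdgeCover V, IsExactMaximizer halfEdgeShare f' →
      AchievesPoA tourShare (roundedMechanism tourShare f' (threeTourRounding T)) 9 := by
    intro f' hf'
    rw [← h9]
    exact achievesPoA_roundedMechanism tourShare_le_one hf' (by norm_num) hR (fun _ => le_rfl)
      (smoothForHalfValue_halfEdgeShare hV hf')
  have hmax : 3 ≤ Fintype.card V → ∃ f' : (Edge V → NNReal) → HalfEdgeCover V,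
      IsExactMaximizer halfEdgeShare f' := by
    intro hV3
    obtain ⟨ι, -⟩ := isRelaxation_halfEdgeShare hV3
    have := hT.map ι
    exact exists_isExactMaximizer _
  refine ⟨?_, ⟨isRelaxation_coverShare, exists_isExactMaximizer _, exists_isPatching hV,
    fun f' hf' => smoothForHalfValue_coverShare hf', fun g hg =>
      ⟨isObliviousRounding_fisherRounding hg, fun f' hf' => ?_⟩⟩,
    fun hV3 => ⟨isRelaxation_halfEdgeShare hV3, hmax hV3,
      fun f' hf' => smoothForHalfValue_halfEdgeShare hV hf', T, hR, hPoA⟩⟩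
  · rcases hV.lt_or_eq with hV3 | hV2
    · obtain ⟨f', hf'⟩ := hmax hV3
      exact ⟨_, ⟨HalfEdgeCover V, inferInstance, halfEdgeShare, f', threeTourRounding T,
        isRelaxation_halfEdgeShare hV3, hf', hR, rfl⟩, hPoA f' hf'⟩
    · exact exists_achievesPoA_of_card_eq_two hV2.symm
  · rw [← h12]
    exact achievesPoA_roundedMechanism tourShare_le_one hf' two_ne_zero
      (isObliviousRounding_fisherRounding hg)
      (opt_le_opt_of_isRelaxation isRelaxation_coverShare) (smoothForHalfValue_coverShare hf')
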